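/- Let $k$ be a field and let $A=k\langle a,b,c\mid b^2a=ab^2,\ b^2c=aca,\ acc=0,\ aba=0,\ abc=0,\ cba=0,\ cbc=0\rangle$, graded by $\deg a=\deg b=\deg c=1$, so that $A=\bigoplus_{n\ge 0}A_n$ with $A_n$ the span of the images of the words of length $n$. (1) The infinite rewriting system $$R_\infty=\{b^2a\to ab^2,\ b^2c\to aca,\ aba\to 0,\ abc\to 0,\ cba\to 0,\ cbc\to 0\}\cup\{a^nca^{n-1}c\to 0 : n\ge 1\}$$ on the free monoid with zero on $a,b,c$ is complete (Noetherian and confluent) and equivalent to (generates the same congruence as) the system given by the seven defining relations; the elements $u-v$, for $u\to v$ in $R_\infty$, generate the ideal of relations of $A$. (2) The words irreducible with respect to $R_\infty$ are exactly the words $$b^s a^{m_1}c\,a^{m_2}c\cdots a^{m_r}c\,a^l b^t,\qquad s\in\{0,1\},\ r,l,t\ge 0,\ 0\le m_1\le m_2\le\dots\le m_r,$$ and their images form a basis of $A$. (3) For a finite generating set $S$ of an algebra $B$, let $\gamma_B^S(n)$ be the dimension of the span of the products of at most $n$ elements of $S$; write $f\preceq g$ if there are integers $N,C>0$ with $f(n)\le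 g(Cn)$ for all $n\ge N$, and $f\sim g$ if $f\preceq g\preceq f$. For every finite generating set $S$ of $A$, $\gamma_A^S(n)\sim p(n)\sim e^{\sqrt n}$, where $p(n)$ is the number of partitions of $n$. In particular $A$ has intermediate growth: its growth functions grow faster than every polynomial and slower than every exponential $c^n$, $c>1$. (4) The Veronese subalgebra $V_3(A)=k\oplus A_3\oplus A_6\oplus\cdots$ is a finitely presented quadratic algebra: it has a presentation with $20$ generators, taken from $A_3$, and $281$ linearly independent relations, all homogeneous of degree two in these generators. It has intermediate growth, and its growth functions are $\sim e^{\sqrt n}$. -/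

import Mathlib

open scoped Asymptotics

namespace KobayashiAlgebra

/-! ### Rewriting systems on a free monoid with zero -/

section Rewriting

/-- A rewriting system on words in `X`: a set of rules `u → v`, where `u` is a word and `v` is
a word or zero. -/
abbrev RewritingSystem (X : Type) : Type := Set (FreeMonoid X × WithZero (FreeMonoid X))

variable {X : Type}

/-- One rewriting step `x u y → x v y` for a rule `u → v` and words `x`, `y`. The element `0` of the
free monoid with zero cannot be rewritten. -/
def RewritingSystem.Step (R : RewritingSystem X) (w w' : WithZero (FreeMonoid X)) : Prop :=
  ∃ (x y u : FreeMonoid X) (v : WithZero (FreeMonoid X)), (u, v) ∈ R ∧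
    w = ((x * u * y : FreeMonoid X) : WithZero (FreeMonoid X)) ∧
    w' = (x : WithZero (FreeMonoid X)) * v * (y : WithZero (FreeMonoid X))

/-- There is no infinite sequence of rewriting steps. -/
def RewritingSystem.IsNoetherian (R : RewritingSystem X) : Prop :=
  WellFounded (fun w' w : WithZero (FreeMonoid X) => R.Step w w')

/-- Any two elements obtained from a common one by rewriting can be rewritten to a common one. -/
def RewritingSystem.IsConfluent (R : RewritingSystem X) : Prop :=
  ∀ w w₁ w₂ : WithZero (FreeMonoid X),
    Relation.ReflTransGen R.Step w w₁ → Relation.ReflTransGen R.Step w w₂ →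
      Relation.Join (Relation.ReflTransGen R.Step) w₁ w₂

/-- A complete rewriting system: Noetherian and confluent. -/
def RewritingSystem.IsComplete (R : RewritingSystem X) : Prop :=
  R.IsNoetherian ∧ R.IsConfluent

/-- Two rewriting systems are equivalent if they generate the same congruence on the free monoid
with zero. -/
def RewritingSystem.IsEquivalent (R R' : RewritingSystem X) : Prop :=
  ∀ w w' : WithZero (FreeMonoid X),
    Relation.EqvGen R.Step w w' ↔ Relation.EqvGen R'.Step w w'

/-- The words to which no rewriting step applies. -/
def RewritingSystem.irreducibleWords (R : RewritingSystem X) : Set (FreeMonoid X) :=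
  {w | ∀ w' : WithZero (FreeMonoid X), ¬ R.Step (w : WithZero (FreeMonoid X)) w'}

/-- The monomial of the free algebra given by a word; zero is sent to zero. -/
noncomputable def monomialOf (k : Type*) [Field k] :
    WithZero (FreeMonoid X) →*₀ FreeAlgebra k X :=
  WithZero.lift' (FreeMonoid.lift (FreeAlgebra.ι k))

/-- The elements `u - v` of the free algebra, for the rules `u → v` of a rewriting system. -/
def RewritingSystem.relators (k : Type*) [Field k] (R : RewritingSystem X) :
    Set (FreeAlgebra k X) :=
  {f | ∃ p ∈ R, f = monomialOf k (p.1 : WithZero (FreeMonoid X)) - monomialOf k p.2}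

end Rewriting

/-! ### Growth -/

section Growth

/-- `γ_B^S(n)`: the dimension of the span of all products of at most `n` elements of `S`. -/
noncomputable def growthFunction (k : Type*) [Field k] {B : Type*} [Ring B] [Algebra k B]
    (S : Finset B) (n : ℕ) : ℕ :=
  Module.finrank k
    (Submodule.span k {x : B | ∃ l : List B, (∀ y ∈ l, y ∈ S) ∧ l.length ≤ n ∧ l.prod = x})

/-- `f ⪯ g`: there are `N, C > 0` with `f n ≤ g (C n)` for all `n ≥ N`. -/
def GrowthLE (f g : ℕ → ℝ) : Prop :=
  ∃ N C : ℕ, 0 < N ∧ 0 < C ∧ ∀ n, N ≤ n → f n ≤ g (C * n)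

/-- `f ∼ g`: `f ⪯ g` and `g ⪯ f`. -/
def GrowthEquiv (f g : ℕ → ℝ) : Prop := GrowthLE f g ∧ GrowthLE g f

/-- `B` is a finitely generated algebra whose growth function, with respect to every finite
generating set, is equivalent to `f`. -/
def HasGrowthType (k : Type*) [Field k] (B : Type*) [Ring B] [Algebra k B] (f : ℕ → ℝ) : Prop :=
  Algebra.FiniteType k B ∧
    ∀ S : Finset B, Algebra.adjoin k (S : Set B) = ⊤ →
      GrowthEquiv (fun n => (growthFunction k S n : ℝ)) f

/-- `B` is a finitely generated algebra whose growth function, with respect to every finite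
generating set, grows faster than every polynomial and slower than every exponential. -/
def HasIntermediateGrowth (k : Type*) [Field k] (B : Type*) [Ring B] [Algebra k B] : Prop :=
  Algebra.FiniteType k B ∧
    ∀ S : Finset B, Algebra.adjoin k (S : Set B) = ⊤ →
      (∀ d : ℕ, (fun n : ℕ => (n : ℝ) ^ d) =o[Filter.atTop]
        fun n : ℕ => (growthFunction k S n : ℝ)) ∧
      (∀ c : ℝ, 1 < c → (fun n : ℕ => (growthFunction k S n : ℝ)) =o[Filter.atTop]
        fun n : ℕ => c ^ n)

/-- The partition function `p(n)`. -/
def partitionCount (n : ℕ) : ℕ := Fintype.card (Nat.Partition n)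

end Growth

/-! ### Homogeneous components, Veronese subalgebras, quadratic presentations -/

section Graded

variable (k : Type*) [Field k] {B : Type*} [Ring B] [Algebra k B] {X : Type*}

/-- The span of all products of exactly `n` of the elements `x i`: the component of degree `n` when
`B` is generated by the `x i` with all `x i` of degree one. -/
def component (x : X → B) (n : ℕ) : Submodule k B :=
  Submodule.span k {y | ∃ l : List X, l.length = n ∧ (l.map x).prod = y}

theorem one_mem_component (x : X → B) : (1 : B) ∈ component k x 0 :=
  Submodule.subset_span ⟨[], rfl, rfl⟩

theorem component_mul (x : X → B) (m n : ℕ) :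
    component k x m * component k x n ≤ component k x (m + n) := by
  unfold component
  rw [Submodule.span_mul_span]
  refine Submodule.span_mono ?_
  rintro _ ⟨_, ⟨l, hl, rfl⟩, _, ⟨l', hl', rfl⟩, rfl⟩
  exact ⟨l ++ l', by simp [hl, hl'], by simp⟩

/-- The Veronese subalgebra `V_d = B_0 + B_d + B_{2d} + ⋯`. -/
def veronese (x : X → B) (d : ℕ) : Subalgebra k B :=
  Submodule.toSubalgebra (⨆ n : ℕ, component k x (d * n))
    (Submodule.mem_iSup_of_mem 0 (one_mem_component k x))
    (by
      intro y z hy hz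
      have h : (⨆ n : ℕ, component k x (d * n)) * (⨆ n : ℕ, component k x (d * n)) ≤
          ⨆ n : ℕ, component k x (d * n) := by
        rw [Submodule.iSup_mul]
        refine iSup_le fun m => ?_
        rw [Submodule.mul_iSup]
        refine iSup_le fun n => ?_
        refine (component_mul k x (d * m) (d * n)).trans ?_
        rw [← mul_add]
        exact le_iSup (fun n : ℕ => component k x (d * n)) (m + n)
      exact h (Submodule.mul_mem_mul hy hz))

/-- The component `B_{dn}` of degree `n` of the Veronese subalgebra `V_d`. -/
def veroneseComponent (x : X → B) (d n : ℕ) : Submodule k (veronese k x d) :=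
  (component k x (d * n)).comap (veronese k x d).val.toLinearMap

/-- `B` is a quadratic algebra with exactly `g` generators, all lying in the subspace `B₁`, and
exactly `r` linearly independent relations, each of them homogeneous of degree two. -/
def HasQuadraticPresentation (k : Type*) [Field k] (B : Type*) [Ring B] [Algebra k B]
    (B₁ : Submodule k B) (g r : ℕ) : Prop :=
  ∃ (φ : FreeAlgebra k (Fin g) →ₐ[k] B) (ρ : Fin r → FreeAlgebra k (Fin g)),
    Function.Surjective φ ∧
    (∀ i, φ (FreeAlgebra.ι k i) ∈ B₁) ∧
    (∀ j, ρ j ∈ component k (FreeAlgebra.ι k : Fin g → FreeAlgebra k (Fin g)) 2) ∧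
    LinearIndependent k ρ ∧
    TwoSidedIdeal.ker φ = TwoSidedIdeal.span (Set.range ρ)

end Graded

/-! ### The algebra `A` and its rewriting systems -/

section TheAlgebra

/-- The three generators. -/
inductive Letter : Type
  | a
  | b
  | c

/-- The generator `a` as a word. -/
def wa : FreeMonoid Letter := FreeMonoid.of Letter.a

/-- The generator `b` as a word. -/
def wb : FreeMonoid Letter := FreeMonoid.of Letter.b

/-- The generator `c` as a word. -/
def wc : FreeMonoid Letter := FreeMonoid.of Letter.c

/-- The seven rules given by the defining relations. -/
def ruleSet : RewritingSystem Letter :=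
  {(wb * wb * wa, ((wa * wb * wb : FreeMonoid Letter) : WithZero (FreeMonoid Letter))),
   (wb * wb * wc, ((wa * wc * wa : FreeMonoid Letter) : WithZero (FreeMonoid Letter))),
   (wa * wc * wc, 0), (wa * wb * wa, 0), (wa * wb * wc, 0), (wc * wb * wa, 0), (wc * wb * wc, 0)}

/-- The infinite system `R_∞`: the rules `b²a → ab²`, `b²c → aca`, `aba → 0`, `abc → 0`, `cba → 0`,
`cbc → 0`, and `aⁿ c aⁿ⁻¹ c → 0` for all `n ≥ 1`. -/
def ruleSetInf : RewritingSystem Letter :=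
  {(wb * wb * wa, ((wa * wb * wb : FreeMonoid Letter) : WithZero (FreeMonoid Letter))),
   (wb * wb * wc, ((wa * wc * wa : FreeMonoid Letter) : WithZero (FreeMonoid Letter))),
   (wa * wb * wa, 0), (wa * wb * wc, 0), (wc * wb * wa, 0), (wc * wb * wc, 0)} ∪
  {p | ∃ n : ℕ, p = (wa ^ (n + 1) * wc * wa ^ n * wc, 0)}

/-- The words `b^s a^{m₁} c a^{m₂} c ⋯ a^{m_r} c a^l b^t` with `s ∈ {0, 1}`, `r, l, t ≥ 0` and
`0 ≤ m₁ ≤ ⋯ ≤ m_r`. -/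
def normalWords : Set (FreeMonoid Letter) :=
  {w | ∃ (s l t : ℕ) (m : List ℕ), s ≤ 1 ∧ m.Pairwise (· ≤ ·) ∧
    w = wb ^ s * (m.map fun i => wa ^ i * wc).prod * wa ^ l * wb ^ t}

variable (k : Type*) [Field k]

/-- The defining relations `b²a = ab²`, `b²c = aca`, `acc = 0`, `aba = 0`, `abc = 0`, `cba = 0`,
`cbc = 0`, in the free algebra on `a, b, c`. -/
inductive Rel : FreeAlgebra k Letter → FreeAlgebra k Letter → Prop
  | bba : Rel (FreeAlgebra.ι k Letter.b ^ 2 * FreeAlgebra.ι k Letter.a)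
      (FreeAlgebra.ι k Letter.a * FreeAlgebra.ι k Letter.b ^ 2)
  | bbc : Rel (FreeAlgebra.ι k Letter.b ^ 2 * FreeAlgebra.ι k Letter.c)
      (FreeAlgebra.ι k Letter.a * FreeAlgebra.ι k Letter.c * FreeAlgebra.ι k Letter.a)
  | acc : Rel (FreeAlgebra.ι k Letter.a * FreeAlgebra.ι k Letter.c * FreeAlgebra.ι k Letter.c) 0
  | aba : Rel (FreeAlgebra.ι k Letter.a * FreeAlgebra.ι k Letter.b * FreeAlgebra.ι k Letter.a) 0
  | abc : Rel (FreeAlgebra.ι k Letter.a * FreeAlgebra.ι k Letter.b * FreeAlgebra.ι k Letter.c) 0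
  | cba : Rel (FreeAlgebra.ι k Letter.c * FreeAlgebra.ι k Letter.b * FreeAlgebra.ι k Letter.a) 0
  | cbc : Rel (FreeAlgebra.ι k Letter.c * FreeAlgebra.ι k Letter.b * FreeAlgebra.ι k Letter.c) 0

/-- The algebra `A = ⟨a, b, c ∣ b²a = ab², b²c = aca, acc = aba = abc = cba = cbc = 0⟩`. -/
abbrev A : Type _ := RingQuot (Rel k)

/-- The canonical projection of the free algebra onto `A`. -/
noncomputable abbrev proj : FreeAlgebra k Letter →ₐ[k] A k := RingQuot.mkAlgHom k (Rel k)

/-- The generators of `A`. -/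
noncomputable def gen (x : Letter) : A k := proj k (FreeAlgebra.ι k x)

/-- The element of `A` represented by a word. -/
noncomputable def wordImage (w : FreeMonoid Letter) : A k :=
  proj k (monomialOf k (w : WithZero (FreeMonoid Letter)))

end TheAlgebra

end KobayashiAlgebra

/-! The core is one explicit left action of the letters on normal forms, `act`. It satisfies the
seven defining relations (`runZero_eq_of_mem_ruleSet`), so the result of letting a word act on the
empty word, `normalForm`, is an invariant of the congruence. Each clause of the action is also
realised by rewriting with `ruleSetInf` (`red_act`), so every word rewrites to its normal form.
Confluence follows with no analysis of critical pairs; termination comes from reading words as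
binary numbers. The linearised action is a representation of `A` under which distinct normal words
send the vector of the empty word to distinct basis vectors, whence the basis and the grading.

Growth: a block `a ^ i c` has length `i + 1`, so a nondecreasing sequence of blocks is a partition
of its total length, and the remaining data `s`, `l`, `t` contribute only a polynomial factor. The
bounds on `p(n)` are elementary: truncated Euler product at `x = s / (s + 1)` with `s` about `√n`
for the upper one, sums of distinct parts for the lower one. Constants in the exponent disappear
under the rescaling of `n` that `GrowthLE` allows.

Veronese subalgebra: cut a word of length `3n` into blocks of three letters. A defining relation has
degree three, so an occurrence of it meets one block, where it is absorbed by the normal form of the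
block, or two adjacent blocks, where it is a relation of degree two between the generators
(`quadraticMk_chop_rule`). Hence the kernel is generated in degree two (`ker_tripleHom`), and
counting normal words of lengths three and six gives 20 generators and `400 - 119 = 281` relations.
-/

namespace KobayashiAlgebra

/-! ### Congruence properties of rewriting -/

section Rewriting

variable {X : Type} {R : RewritingSystem X}

theorem RewritingSystem.Step.mul_mul {w w' : WithZero (FreeMonoid X)} (h : R.Step w w')
    (p q : FreeMonoid X) : R.Step (p * w * q) (p * w' * q) := by
  obtain ⟨x, y, u, v, hr, rfl, rfl⟩ := h
  refine ⟨p * x, y * q, u, v, hr, ?_, ?_⟩ <;> (push_cast; simp only [mul_assoc])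

theorem RewritingSystem.Step.of_mem {u : FreeMonoid X} {v : WithZero (FreeMonoid X)}
    (h : (u, v) ∈ R) : R.Step u v :=
  ⟨1, 1, u, v, h, by simp, by simp⟩

theorem reflTransGen_mul_mul {w w' : WithZero (FreeMonoid X)}
    (h : Relation.ReflTransGen R.Step w w') (p q : FreeMonoid X) :
    Relation.ReflTransGen R.Step (p * w * q) (p * w' * q) :=
  h.lift (fun z : WithZero (FreeMonoid X) => (p : WithZero (FreeMonoid X)) * z * q)
    fun _ _ hs => hs.mul_mul p q

theorem reflTransGen_mul_left {w w' : WithZero (FreeMonoid X)}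
    (h : Relation.ReflTransGen R.Step w w') (p : FreeMonoid X) :
    Relation.ReflTransGen R.Step (p * w) (p * w') := by
  simpa using reflTransGen_mul_mul h p 1

theorem reflTransGen_mul_right {w w' : WithZero (FreeMonoid X)}
    (h : Relation.ReflTransGen R.Step w w') (q : FreeMonoid X) :
    Relation.ReflTransGen R.Step (w * q) (w' * q) := by
  simpa using reflTransGen_mul_mul h 1 q

theorem eqvGen_mul_mul {w w' : WithZero (FreeMonoid X)} (h : Relation.EqvGen R.Step w w')
    (p q : FreeMonoid X) : Relation.EqvGen R.Step (p * w * q) (p * w' * q) := by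
  induction h with
  | rel _ _ h => exact .rel _ _ (h.mul_mul p q)
  | refl => exact .refl _
  | symm _ _ _ ih => exact .symm _ _ ih
  | trans _ _ _ _ _ ih₁ ih₂ => exact .trans _ _ _ ih₁ ih₂

theorem eqvGen_of_reflTransGen {w w' : WithZero (FreeMonoid X)}
    (h : Relation.ReflTransGen R.Step w w') : Relation.EqvGen R.Step w w' := by
  induction h with
  | refl => exact .refl _
  | tail _ h ih => exact .trans _ _ _ ih (.rel _ _ h)

/-- If the rules of `R'` hold in the congruence of `R`, the congruence of `R'` is contained in
that of `R`. -/
theorem eqvGen_mono_of_rules {R' : RewritingSystem X}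
    (h : ∀ u v, (u, v) ∈ R' → Relation.EqvGen R.Step (u : WithZero (FreeMonoid X)) v)
    {w w' : WithZero (FreeMonoid X)} (hw : Relation.EqvGen R'.Step w w') :
    Relation.EqvGen R.Step w w' := by
  induction hw with
  | rel _ _ hs =>
    obtain ⟨x, y, u, v, hr, rfl, rfl⟩ := hs
    simpa using eqvGen_mul_mul (h u v hr) x y
  | refl => exact .refl _
  | symm _ _ _ ih => exact .symm _ _ ih
  | trans _ _ _ _ _ ih₁ ih₂ => exact .trans _ _ _ ih₁ ih₂

end Rewriting

/-! ### The two rewriting systems -/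

section Systems

local notation "W" => FreeMonoid Letter
local notation "W₀" => WithZero (FreeMonoid Letter)

theorem coe_mul_word (u v : W) : ((u * v : W) : W₀) = (u : W₀) * (v : W₀) := rfl

theorem ruleSetInf_infinite : ruleSetInf.Infinite := by
  refine Set.Infinite.mono Set.subset_union_right ?_
  refine Set.infinite_of_injective_forall_mem
    (f := fun n : ℕ => ((wa ^ (n + 1) * wc * wa ^ n * wc, 0) : W × W₀)) ?_ fun n => ⟨n, rfl⟩
  intro m n h
  -- The `n`-th left-hand side has length `2n + 3`.
  have h' := congrArg FreeMonoid.length (Prod.mk.inj h).1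
  have hp : ∀ n, (wa ^ n).length = n := fun n => by
    induction n with
    | zero => rfl
    | succ n ih => rw [pow_succ, FreeMonoid.length_mul, ih]; rfl
  simp only [FreeMonoid.length_mul, hp] at h'
  omega

theorem mem_ruleSet_bba : (wb * wb * wa, ((wa * wb * wb : W) : W₀)) ∈ ruleSet := by simp [ruleSet]
theorem mem_ruleSet_bbc : (wb * wb * wc, ((wa * wc * wa : W) : W₀)) ∈ ruleSet := by simp [ruleSet]
theorem mem_ruleSet_acc : (wa * wc * wc, (0 : W₀)) ∈ ruleSet := by simp [ruleSet]

theorem step_bba : ruleSetInf.Step ((wb * wb * wa : W) : W₀) ((wa * wb * wb : W) : W₀) :=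
  .of_mem (by simp [ruleSetInf])
theorem step_bbc : ruleSetInf.Step ((wb * wb * wc : W) : W₀) ((wa * wc * wa : W) : W₀) :=
  .of_mem (by simp [ruleSetInf])
theorem step_aba : ruleSetInf.Step ((wa * wb * wa : W) : W₀) 0 :=
  .of_mem (by simp [ruleSetInf])
theorem step_abc : ruleSetInf.Step ((wa * wb * wc : W) : W₀) 0 :=
  .of_mem (by simp [ruleSetInf])
theorem step_cba : ruleSetInf.Step ((wc * wb * wa : W) : W₀) 0 :=
  .of_mem (by simp [ruleSetInf])
theorem step_cbc : ruleSetInf.Step ((wc * wb * wc : W) : W₀) 0 :=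
  .of_mem (by simp [ruleSetInf])
theorem step_acac (n : ℕ) : ruleSetInf.Step ((wa ^ (n + 1) * wc * wa ^ n * wc : W) : W₀) 0 :=
  .of_mem (Or.inr ⟨n, rfl⟩)

/-- `b²` moves to the right of powers of `a`. -/
theorem reflTransGen_bb_apow {R : RewritingSystem Letter}
    (h : R.Step ((wb * wb * wa : W) : W₀) ((wa * wb * wb : W) : W₀)) (n : ℕ) :
    Relation.ReflTransGen R.Step ((wb * wb * wa ^ n : W) : W₀) ((wa ^ n * wb * wb : W) : W₀) := by
  induction n with
  | zero => simp only [pow_zero, mul_one, one_mul]; exact .refl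
  | succ n ih =>
    have h1 := reflTransGen_mul_right ih wa
    have h2 := reflTransGen_mul_left (Relation.ReflTransGen.single h) (wa ^ n)
    simp only [← coe_mul_word] at h1 h2
    rw [pow_succ]
    simp only [mul_assoc] at h1 h2 ⊢
    exact h1.trans h2

/-- Induction on `n`: the word `b² a^(n+1) c a^n c` is congruent to zero by the previous case.
Moving `b²` to the right past the powers of `a` and replacing `b²c` by `aca` turns it into `a^(n+2)
c a^(n+1) c`. -/
theorem eqvGen_acac (n : ℕ) :
    Relation.EqvGen ruleSet.Step ((wa ^ (n + 1) * wc * wa ^ n * wc : W) : W₀) 0 := by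
  induction n with
  | zero =>
    simpa using Relation.EqvGen.rel _ _ (RewritingSystem.Step.of_mem mem_ruleSet_acc)
  | succ n ih =>
    have h1 := eqvGen_mul_mul ih (wb * wb) 1
    have h2 := eqvGen_mul_mul (eqvGen_of_reflTransGen
      (reflTransGen_bb_apow (.of_mem mem_ruleSet_bba) (n + 1))) 1 (wc * wa ^ n * wc)
    have h3 := eqvGen_mul_mul (.rel _ _ (RewritingSystem.Step.of_mem mem_ruleSet_bbc))
      (wa ^ (n + 1)) (wa ^ n * wc)
    simp only [← coe_mul_word, mul_zero, zero_mul] at h1 h2 h3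
    rw [pow_succ wa (n + 1), pow_succ' wa n] at *
    simp only [mul_assoc, one_mul, mul_one] at h1 h2 h3 ⊢
    exact .trans _ _ _ (.trans _ _ _ (.symm _ _ h3) (.symm _ _ h2)) h1

theorem ruleSetInf_isEquivalent : ruleSetInf.IsEquivalent ruleSet := by
  intro w w'
  constructor
  · refine eqvGen_mono_of_rules ?_
    rintro u v (h | ⟨n, h⟩)
    · refine .rel _ _ (.of_mem ?_)
      simp only [ruleSet, Set.mem_insert_iff, Set.mem_singleton_iff] at h ⊢
      tauto
    · obtain ⟨rfl, rfl⟩ := Prod.mk.inj h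
      exact eqvGen_acac n
  · refine eqvGen_mono_of_rules ?_
    intro u v h
    refine .rel _ _ (.of_mem ?_)
    simp only [ruleSet, Set.mem_insert_iff, Set.mem_singleton_iff] at h
    rcases h with h | h | h | h | h | h | h
    · exact .inl (by simp [h])
    · exact .inl (by simp [h])
    · exact .inr ⟨0, by simpa using h⟩
    all_goals exact .inl (by simp [h])

/-- The value of a word read in base two with digits `b = 1`, `a = c = 0`. -/
def binaryValue : List Letter → ℕ
  | [] => 0
  | .b :: w => 2 ^ w.length + binaryValue w
  | _ :: w => binaryValue w

theorem binaryValue_append (u v : List Letter) :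
    binaryValue (u ++ v) = binaryValue u * 2 ^ v.length + binaryValue v := by
  induction u with
  | nil => simp [binaryValue]
  | cons x u ih => cases x <;> (simp [binaryValue, ih, pow_add]; try ring)

/-- A measure that decreases along rewriting steps of `ruleSetInf`. -/
def rewritingMeasure : W₀ → ℕ
  | none => 0
  | some w => binaryValue w.toList + 1

/-- The two rules with nonzero right-hand side preserve length and lower the binary value (`110` to
`011` and `110` to `000`), in any context. The summand `1` in the measure places every word above
zero. -/
theorem rewritingMeasure_lt {w w' : W₀} (h : ruleSetInf.Step w w') :
    rewritingMeasure w' < rewritingMeasure w := by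
  obtain ⟨x, y, u, v, hr, rfl, rfl⟩ := h
  have h0 : rewritingMeasure ((x : W₀) * 0 * y) < rewritingMeasure ((x * u * y : W) : W₀) := by
    rw [mul_zero, zero_mul]; exact Nat.succ_pos _
  have key : ∀ u' : W, u'.length = u.length →
      binaryValue u'.toList < binaryValue u.toList →
      rewritingMeasure ((x : W₀) * u' * y) < rewritingMeasure ((x * u * y : W) : W₀) := by
    intro u' hl hu
    change binaryValue (x * u' * y).toList + 1 < binaryValue (x * u * y).toList + 1
    simp only [FreeMonoid.toList_mul, binaryValue_append]
    have hl' : u'.toList.length = u.toList.length := hl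
    rw [hl']
    have : 0 < 2 ^ y.toList.length := by positivity
    gcongr
  rcases hr with hr | ⟨n, hr⟩
  · simp only [Set.mem_insert_iff, Set.mem_singleton_iff, Prod.mk.injEq] at hr
    rcases hr with ⟨rfl, rfl⟩ | ⟨rfl, rfl⟩ | ⟨rfl, rfl⟩ | ⟨rfl, rfl⟩ | ⟨rfl, rfl⟩ | ⟨rfl, rfl⟩
    · exact key _ rfl (by decide)
    · exact key _ rfl (by decide)
    all_goals exact h0
  · obtain ⟨rfl, rfl⟩ := Prod.mk.inj hr
    exact h0

theorem ruleSetInf_isNoetherian : ruleSetInf.IsNoetherian :=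
  Subrelation.wf (fun h => rewritingMeasure_lt h) (measure rewritingMeasure).wf

/-! ### Normal forms -/

/-- Data for the normal words: `pow t` for `b ^ t`, `apow s l t` for `b ^ s a ^ (l + 1) b ^ t`, and
`cword s i m l t` for `b ^ s (a ^ i c) (a ^ m₁ c) ⋯ (a ^ mᵣ c) a ^ l b ^ t`. -/
inductive NormalForm : Type
  | pow (t : ℕ)
  | apow (s : Bool) (l t : ℕ)
  | cword (s : Bool) (i : ℕ) (m : List ℕ) (l t : ℕ)

open NormalForm

/-- Left multiplication of a normal form by a letter; `none` stands for zero. -/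
def act : Letter → NormalForm → Option NormalForm
  | .a, pow t => some (apow false 0 t)
  | .a, apow false l t => some (apow false (l + 1) t)
  | .a, cword false i [] l t => some (cword false (i + 1) [] l t)
  -- The new prefix is `a^(i+1) c a^j c`, which contains some `a^(n+1) c a^n c` as soon as `j < i +
  -- 1`.
  | .a, cword false i (j :: m) l t =>
    if i + 1 ≤ j then some (cword false (i + 1) (j :: m) l t) else none
  | .a, apow true _ _ => none
  | .a, cword true _ _ _ _ => none
  | .c, pow t => some (cword false 0 [] 0 t)
  | .c, apow false l t => some (cword false 0 [] (l + 1) t)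
  | .c, cword false i m l t => some (cword false 0 (i :: m) l t)
  | .c, apow true _ _ => none
  | .c, cword true _ _ _ _ => none
  | .b, pow t => some (pow (t + 1))
  | .b, apow false l t => some (apow true l t)
  | .b, cword false i m l t => some (cword true i m l t)
  -- From here on a second `b` meets the first. Their square passes all powers of `a`; if it reaches
  -- a `c`, then `b²c = aca` raises the exponent of that block by one and leaves an `a` for the next
  -- block, or for the final power of `a`.
  | .b, apow true l t => some (apow false l (t + 2))
  | .b, cword true i [] l t => some (cword false (i + 1) [] (l + 1) t)
  | .b, cword true i [j] l t => some (cword false (i + 1) [j + 1] l t)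
  | .b, cword true i (j :: h :: m) l t =>
    if j + 1 ≤ h then some (cword false (i + 1) ((j + 1) :: h :: m) l t) else none

/-- The action of words on normal forms and zero. -/
def run (w : W) (o : Option NormalForm) : Option NormalForm :=
  w.toList.foldr (fun x o => o.bind (act x)) o

theorem run_mul (u v : W) (o : Option NormalForm) : run (u * v) o = run u (run v o) := by
  rw [run, FreeMonoid.toList_mul, List.foldr_append]; rfl

@[simp] theorem run_one (o : Option NormalForm) : run 1 o = o := rfl
@[simp] theorem run_of (x : Letter) (o : Option NormalForm) :
    run (FreeMonoid.of x) o = o.bind (act x) := rfl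
@[simp] theorem run_wa (o : Option NormalForm) : run wa o = o.bind (act .a) := rfl
@[simp] theorem run_wb (o : Option NormalForm) : run wb o = o.bind (act .b) := rfl
@[simp] theorem run_wc (o : Option NormalForm) : run wc o = o.bind (act .c) := rfl

@[simp] theorem run_none (w : W) : run w none = none := by
  induction w using FreeMonoid.inductionOn' with
  | one => simp
  | of_mul x w ih => rw [run_mul, ih]; simp

/-- The action of words and zero. -/
def runZero : W₀ → Option NormalForm → Option NormalForm
  | none, _ => none
  | some w, o => run w o

@[simp] theorem runZero_zero (o : Option NormalForm) : runZero 0 o = none := rfl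
@[simp] theorem runZero_coe (w : W) (o : Option NormalForm) : runZero (w : W₀) o = run w o := rfl

theorem runZero_mul (u v : W₀) (o : Option NormalForm) :
    runZero (u * v) o = runZero u (runZero v o) := by
  induction u using WithZero.recZeroCoe with
  | zero => simp
  | coe u =>
    induction v using WithZero.recZeroCoe with
    | zero => simp
    | coe v => exact run_mul u v o

/-- A finite case check, on unsorted data as well. For `b²a = ab²` the guards agree since `i + 1 ≤
j` is `i + 2 ≤ j + 1`; for `acc = 0` the test `1 ≤ 0` fails. -/
theorem runZero_eq_of_mem_ruleSet {u : W} {v : W₀} (h : (u, v) ∈ ruleSet)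
    (o : Option NormalForm) : run u o = runZero v o := by
  simp only [ruleSet, Set.mem_insert_iff, Set.mem_singleton_iff, Prod.mk.injEq] at h
  rcases o with _ | d
  · rw [run_none]
    induction v using WithZero.recZeroCoe <;> simp only [runZero_coe, runZero_zero, run_none]
  rcases h with ⟨rfl, rfl⟩ | ⟨rfl, rfl⟩ | ⟨rfl, rfl⟩ | ⟨rfl, rfl⟩ | ⟨rfl, rfl⟩ | ⟨rfl, rfl⟩ |
    ⟨rfl, rfl⟩ <;>
  rcases d with t | ⟨_ | _, l, t⟩ | ⟨_ | _, i, _ | ⟨j, _ | ⟨h, m⟩⟩, l, t⟩ <;>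
  simp only [runZero_coe, runZero_zero, run_mul, run_wa, run_wb, run_wc, Option.bind_some, act,
    Option.bind_none] <;>
  (try split_ifs) <;>
  (try simp only [Option.bind_some, act, Option.bind_none]) <;>
  (try split_ifs) <;> (first | done | rfl | omega)

theorem runZero_eq_of_eqvGen {w w' : W₀} (h : Relation.EqvGen ruleSet.Step w w')
    (o : Option NormalForm) : runZero w o = runZero w' o := by
  induction h with
  | rel _ _ hs =>
    obtain ⟨x, y, u, v, hr, rfl, rfl⟩ := hs
    simp only [runZero_mul, runZero_coe, run_mul]
    rw [runZero_eq_of_mem_ruleSet hr]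
  | refl => rfl
  | symm _ _ _ ih => exact ih.symm
  | trans _ _ _ _ _ ih₁ ih₂ => exact ih₁.trans ih₂

end Systems

end KobayashiAlgebra

namespace KobayashiAlgebra

/-! ### Reduction to normal form and confluence. -/

section NormalWords

open NormalForm

local notation "W" => FreeMonoid Letter
local notation "W₀" => WithZero (FreeMonoid Letter)

/-- The word `(a ^ m₁ c) ⋯ (a ^ mᵣ c)`. -/
def blocks (m : List ℕ) : W := (m.map fun i => wa ^ i * wc).prod

@[simp] theorem blocks_nil : blocks [] = 1 := rfl
@[simp] theorem blocks_cons (i : ℕ) (m : List ℕ) : blocks (i :: m) = wa ^ i * wc * blocks m := by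
  simp [blocks]

/-- The word described by a normal form. -/
def NormalForm.toWord : NormalForm → W
  | pow t => wb ^ t
  | apow s l t => wb ^ s.toNat * wa ^ (l + 1) * wb ^ t
  | cword s i m l t => wb ^ s.toNat * blocks (i :: m) * wa ^ l * wb ^ t

/-- The word, or zero, described by a normal form, or `none`. -/
def decode : Option NormalForm → W₀
  | none => 0
  | some d => (d.toWord : W₀)

@[simp] theorem decode_none : decode none = 0 := rfl
@[simp] theorem decode_some (d : NormalForm) : decode (some d) = (d.toWord : W₀) := rfl

local infix:50 " ⟶* " => Relation.ReflTransGen (RewritingSystem.Step ruleSetInf)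

theorem red_mul_mul {u : W} {v : W₀} (h : ruleSetInf.Step (u : W₀) v) (p q : W) :
    ((p * u * q : W) : W₀) ⟶* p * v * q :=
  reflTransGen_mul_mul (.single h) p q

theorem red_zero {u : W} (h : ruleSetInf.Step (u : W₀) 0) (p q : W) :
    ((p * u * q : W) : W₀) ⟶* 0 := by
  simpa using red_mul_mul h p q

theorem red_acac {p q : ℕ} (h : q < p) (y : W) :
    ((wa ^ p * wc * wa ^ q * wc * y : W) : W₀) ⟶* 0 := by
  have := red_zero (step_acac q) (wa ^ (p - (q + 1))) y
  rw [← Nat.sub_add_cancel (Nat.succ_le_of_lt h), pow_add]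
  simpa only [mul_assoc] using this

/-- `b²` passes `a^i` and is then consumed by the rule `b²c → aca`. -/
theorem red_bb_block (i : ℕ) (y : W) :
    ((wb * wb * wa ^ i * wc * y : W) : W₀) ⟶* ((wa ^ (i + 1) * wc * wa * y : W) : W₀) := by
  have h1 := reflTransGen_mul_right (reflTransGen_bb_apow step_bba i) (wc * y)
  have h2 := red_mul_mul step_bbc (wa ^ i) y
  simp only [← coe_mul_word] at h1 h2
  rw [pow_succ]
  simp only [mul_assoc] at h1 h2 ⊢
  exact h1.trans h2

/-- This ties the abstract action to rewriting: prepending a letter to a normal form can be reduced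
to what `act` prescribes, by rules of `ruleSetInf` only. -/
theorem red_act (x : Letter) (d : NormalForm) :
    ((FreeMonoid.of x * d.toWord : W) : W₀) ⟶* decode (act x d) := by
  have done : ∀ u v : W, u = v → (u : W₀) ⟶* (v : W₀) := fun u v h => h ▸ .refl
  have hab : ∀ y : W, ((wa * (wb * (wa * y)) : W) : W₀) ⟶* 0 := fun y => by
    simpa only [mul_assoc, one_mul] using red_zero step_aba 1 y
  have hac : ∀ y : W, ((wa * (wb * (wc * y)) : W) : W₀) ⟶* 0 := fun y => by
    simpa only [mul_assoc, one_mul] using red_zero step_abc 1 y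
  have hcb : ∀ y : W, ((wc * (wb * (wa * y)) : W) : W₀) ⟶* 0 := fun y => by
    simpa only [mul_assoc, one_mul] using red_zero step_cba 1 y
  have hcc : ∀ y : W, ((wc * (wb * (wc * y)) : W) : W₀) ⟶* 0 := fun y => by
    simpa only [mul_assoc, one_mul] using red_zero step_cbc 1 y
  rcases x with _ | _ | _
  · change ((wa * d.toWord : W) : W₀) ⟶* _
    rcases d with t | ⟨_ | _, l, t⟩ | ⟨_ | _, i, _ | ⟨j, m⟩, l, t⟩ <;>
      simp only [act, toWord, decode_some, decode_none, blocks_cons, blocks_nil, Bool.toNat_true,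
        Bool.toNat_false, pow_zero, pow_one, mul_one, one_mul, zero_add]
    · exact .refl
    · exact done _ _ (by rw [pow_succ' wa (l + 1)]; simp only [mul_assoc])
    · rw [pow_succ']; simpa only [mul_assoc] using hab _
    · exact done _ _ (by rw [pow_succ' wa i]; simp only [mul_assoc])
    · split_ifs with h
      · exact done _ _ (by simp only [toWord, blocks_cons, pow_succ' wa i, mul_assoc,
          Bool.toNat_false, pow_zero, one_mul])
      · have := red_acac (p := i + 1) (q := j) (by omega) (blocks m * wa ^ l * wb ^ t)
        simpa only [pow_succ' wa i, mul_assoc, decode_none] using this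
    -- The word begins with `abc` if `i = 0` and with `aba` otherwise.
    all_goals
      rcases i with _ | i
      · simpa only [mul_assoc, pow_zero, one_mul] using hac _
      · rw [pow_succ' wa i]; simpa only [mul_assoc] using hab _
  · change ((wb * d.toWord : W) : W₀) ⟶* _
    rcases d with t | ⟨_ | _, l, t⟩ | ⟨_ | _, i, _ | ⟨j, _ | ⟨h, m⟩⟩, l, t⟩ <;>
      simp only [act, toWord, decode_some, blocks_cons, blocks_nil,
        Bool.toNat_true, Bool.toNat_false, pow_zero, pow_one, mul_one, one_mul]
    · exact done _ _ (by rw [pow_succ'])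
    · exact done _ _ (by simp only [mul_assoc])
    · have := reflTransGen_mul_right (reflTransGen_bb_apow step_bba (l + 1)) (wb ^ t)
      simp only [← coe_mul_word] at this
      rw [pow_succ' wb (t + 1), pow_succ' wb t]
      simpa only [mul_assoc] using this
    · exact done _ _ (by simp only [mul_assoc])
    · exact done _ _ (by simp only [mul_assoc])
    · exact done _ _ (by simp only [mul_assoc])
    · have := red_bb_block i (wa ^ l * wb ^ t)
      rw [pow_succ' wa l]
      simpa only [mul_assoc] using this
    · have := red_bb_block i (wa ^ j * wc * wa ^ l * wb ^ t)
      rw [pow_succ' wa j]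
      simpa only [mul_assoc] using this
    · have := red_bb_block i (wa ^ j * wc * (wa ^ h * wc * blocks m) * wa ^ l * wb ^ t)
      split_ifs with hj
      · simp only [decode_some, toWord, blocks_cons, pow_succ' wa j, Bool.toNat_false,
          pow_zero, one_mul]
        simpa only [mul_assoc] using this
      -- The second exponent has grown to `j + 1 > h`, so its block and the next one contain a
      -- left-hand side that reduces to zero.
      · refine Relation.ReflTransGen.trans (b := ((wa ^ (i + 1) * wc *
          (wa ^ (j + 1) * wc * wa ^ h * wc * (blocks m * wa ^ l * wb ^ t)) : W) : W₀)) ?_ ?_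
        · rw [pow_succ' wa j]
          simpa only [mul_assoc] using this
        · have := reflTransGen_mul_left (red_acac (p := j + 1) (q := h) (by omega)
            (blocks m * wa ^ l * wb ^ t)) (wa ^ (i + 1) * wc)
          simpa only [← coe_mul_word, mul_zero, decode_none] using this
  · change ((wc * d.toWord : W) : W₀) ⟶* _
    rcases d with t | ⟨_ | _, l, t⟩ | ⟨_ | _, i, m, l, t⟩ <;>
      simp only [act, toWord, decode_some, decode_none, blocks_cons, blocks_nil, Bool.toNat_true,
        Bool.toNat_false, pow_zero, pow_one, mul_one, one_mul]
    · exact .refl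
    · exact done _ _ (by simp only [mul_assoc])
    · rw [pow_succ']; simpa only [mul_assoc] using hcb _
    · exact done _ _ (by simp only [mul_assoc])
    · rcases i with _ | i
      · simpa only [mul_assoc, pow_zero, one_mul] using hcc _
      · rw [pow_succ' wa i]; simpa only [mul_assoc] using hcb _

/-- The normal form of a word or zero. -/
def normalForm (w : W₀) : Option NormalForm := runZero w (some (pow 0))

@[simp] theorem normalForm_zero : normalForm 0 = none := rfl

theorem normalForm_coe (w : W) : normalForm (w : W₀) = run w (some (pow 0)) := rfl

theorem red_run (w : W) (o : Option NormalForm) :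
    (w : W₀) * decode o ⟶* decode (run w o) := by
  induction w using FreeMonoid.inductionOn' with
  | one => rw [run_one, WithZero.coe_one, one_mul]
  | of_mul x w ih =>
    have h := reflTransGen_mul_left ih (FreeMonoid.of x)
    rw [coe_mul_word, mul_assoc, run_mul, run_of]
    refine h.trans ?_
    rcases run w o with _ | d
    · simpa using Relation.ReflTransGen.refl
    · exact red_act x d

theorem red_normalForm (w : W₀) : w ⟶* decode (normalForm w) := by
  induction w using WithZero.recZeroCoe with
  | zero => exact .refl
  | coe w => simpa [normalForm_coe, toWord] using red_run w (some (pow 0))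

theorem normalForm_eq_of_eqvGen {w w' : W₀} (h : Relation.EqvGen ruleSet.Step w w') :
    normalForm w = normalForm w' :=
  runZero_eq_of_eqvGen h _

theorem normalForm_eq_of_red {w w' : W₀} (h : w ⟶* w') : normalForm w = normalForm w' :=
  normalForm_eq_of_eqvGen ((ruleSetInf_isEquivalent _ _).1 (eqvGen_of_reflTransGen h))

theorem eqvGen_normalForm (w : W₀) : Relation.EqvGen ruleSet.Step w (decode (normalForm w)) :=
  (ruleSetInf_isEquivalent _ _).1 (eqvGen_of_reflTransGen (red_normalForm w))

/-- Both reducts have the normal form of their common source and rewrite to it. -/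
theorem ruleSetInf_isConfluent : ruleSetInf.IsConfluent := by
  intro w w₁ w₂ h₁ h₂
  refine ⟨decode (normalForm w), ?_, ?_⟩
  · rw [normalForm_eq_of_red h₁]; exact red_normalForm w₁
  · rw [normalForm_eq_of_red h₂]; exact red_normalForm w₂

theorem ruleSetInf_isComplete : ruleSetInf.IsComplete :=
  ⟨ruleSetInf_isNoetherian, ruleSetInf_isConfluent⟩

/-! ### Irreducible words -/

/-- The exponents of `a` in the blocks are nondecreasing. -/
def NormalForm.Sorted : NormalForm → Prop
  | cword _ i m _ _ => (i :: m).Pairwise (· ≤ ·)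
  | _ => True

theorem pairwise_le_cons_cons {i j : ℕ} {m : List ℕ} :
    (i :: j :: m).Pairwise (· ≤ ·) ↔ i ≤ j ∧ (j :: m).Pairwise (· ≤ ·) := by
  rw [← List.isChain_iff_pairwise, List.isChain_cons_cons, List.isChain_iff_pairwise]

/-- Letter `a` raises the first exponent, guarded by the test in `act`; `c` puts a `0` in front; a
second `b` raises the first two exponents together and the test compares the second with the third.
-/
theorem sorted_of_act {x : Letter} {d d' : NormalForm} (hd : d.Sorted) (h : act x d = some d') :
    d'.Sorted := by
  rcases x with _ | _ | _ <;>
  rcases d with t | ⟨_ | _, l, t⟩ | ⟨_ | _, i, _ | ⟨j, _ | ⟨p, m⟩⟩, l, t⟩ <;>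
  simp only [act, Option.some.injEq, reduceCtorEq, Option.ite_none_right_eq_some] at h <;>
  (first | subst h | (obtain ⟨h0, rfl⟩ := h)) <;>
  simp only [NormalForm.Sorted, pairwise_le_cons_cons, List.pairwise_singleton] at hd ⊢ <;>
  first | done | omega | (refine ⟨?_, ?_⟩ <;> first | omega | tauto)

theorem sorted_of_run {w : W} {d d' : NormalForm} (hd : d.Sorted) (h : run w (some d) = some d') :
    d'.Sorted := by
  induction w using FreeMonoid.inductionOn' generalizing d' with
  | one => rw [run_one] at h; cases h; exact hd
  | of_mul x w ih =>
    rw [run_mul, run_of, Option.bind_eq_some_iff] at h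
    obtain ⟨e, he, h⟩ := h
    exact sorted_of_act (ih he) h

theorem sorted_of_normalForm {w : W₀} {d : NormalForm} (h : normalForm w = some d) : d.Sorted := by
  induction w using WithZero.recZeroCoe with
  | zero => simp at h
  | coe w => exact sorted_of_run (d := pow 0) trivial h

theorem mem_normalWords_iff {w : W} :
    w ∈ normalWords ↔ ∃ d : NormalForm, d.Sorted ∧ d.toWord = w := by
  constructor
  · rintro ⟨s, l, t, m, hs, hm, rfl⟩
    change ∃ d : NormalForm, d.Sorted ∧ d.toWord = wb ^ s * blocks m * wa ^ l * wb ^ t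
    obtain ⟨s, rfl⟩ : ∃ b : Bool, s = b.toNat := by
      interval_cases s
      · exact ⟨false, rfl⟩
      · exact ⟨true, rfl⟩
    rcases m with _ | ⟨i, m⟩
    · rcases l with _ | l
      -- With neither blocks nor `a`, the two powers of `b` merge; this is why `pow` carries no flag
      -- `s`.
      · exact ⟨pow (s.toNat + t), trivial, by simp [toWord, pow_add]⟩
      · exact ⟨apow s l t, trivial, by simp [toWord]⟩
    · exact ⟨cword s i m l t, hm, rfl⟩
  · rintro ⟨d, hd, rfl⟩
    rcases d with t | ⟨s, l, t⟩ | ⟨s, i, m, l, t⟩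
    · exact ⟨0, 0, t, [], by simp, by simp, by simp [toWord]⟩
    · exact ⟨s.toNat, l + 1, t, [], s.toNat_le, by simp, by simp [toWord]⟩
    · exact ⟨s.toNat, l, t, i :: m, s.toNat_le, hd, rfl⟩

theorem run_wa_pow_cword (n i : ℕ) (m : List ℕ) (l t : ℕ) (h : ((n + i) :: m).Pairwise (· ≤ ·)) :
    run (wa ^ n) (some (cword false i m l t)) = some (cword false (n + i) m l t) := by
  induction n with
  | zero => simp
  | succ n ih =>
    rcases m with _ | ⟨j, m⟩
    · rw [pow_succ', run_mul, ih (by simp)]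
      simp [act, add_right_comm]
    · rw [pairwise_le_cons_cons] at h
      rw [pow_succ', run_mul, ih (by rw [pairwise_le_cons_cons]; exact ⟨by omega, h.2⟩)]
      simp only [run_wa, Option.bind_some, act]
      rw [if_pos (by omega), add_right_comm]

/-- Built up from right to left, a sorted normal word passes all tests in `act` and never triggers a
second `b` in front of an `a` or `c`. Hence sorted normal forms are determined by their words. -/
theorem run_toWord {d : NormalForm} (hd : d.Sorted) : run d.toWord (some (pow 0)) = some d := by
  have hpow : ∀ t, run (wb ^ t) (some (pow 0)) = some (pow t) := fun t => by
    induction t with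
    | zero => simp
    | succ t ih => rw [pow_succ', run_mul, ih]; rfl
  have hapow : ∀ l t, run (wa ^ (l + 1)) (some (pow t)) = some (apow false l t) := fun l t => by
    induction l with
    | zero => simp [act]
    | succ l ih => rw [pow_succ', run_mul, ih]; rfl
  have hblock : ∀ m i l t, (i :: m).Pairwise (· ≤ ·) →
      run (blocks (i :: m)) (run (wa ^ l) (some (pow t))) = some (cword false i m l t) := by
    intro m
    induction m with
    | nil =>
      intro i l t h
      have h0 : run wc (run (wa ^ l) (some (pow t))) = some (cword false 0 [] l t) := by
        rcases l with _ | l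
        · simp [act]
        · rw [hapow]; rfl
      rw [blocks_cons, blocks_nil, mul_one, run_mul, h0,
        run_wa_pow_cword _ _ _ _ _ (by rwa [add_zero]), add_zero]
    | cons j m ih =>
      intro i l t h
      rw [blocks_cons, run_mul, ih j l t (pairwise_le_cons_cons.1 h).2, run_mul]
      have : run wc (some (cword false j m l t)) = some (cword false 0 (j :: m) l t) := rfl
      rw [this, run_wa_pow_cword _ _ _ _ _ (by rwa [add_zero]), add_zero]
  rcases d with t | ⟨_ | _, l, t⟩ | ⟨_ | _, i, m, l, t⟩
  · exact hpow t
  · simp only [toWord, run_mul, hpow, hapow]; rfl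
  · simp only [toWord, run_mul, hpow, hapow]; rfl
  · simp only [toWord, run_mul, hpow, hblock _ _ _ _ hd]; rfl
  · simp only [toWord, run_mul, hpow, hblock _ _ _ _ hd]; rfl

theorem normalForm_toWord {d : NormalForm} (hd : d.Sorted) :
    normalForm (d.toWord : W₀) = some d := run_toWord hd

theorem mem_normalWords_iff_decode {w : W} :
    w ∈ normalWords ↔ decode (normalForm (w : W₀)) = (w : W₀) := by
  rw [mem_normalWords_iff]
  constructor
  · rintro ⟨d, hd, rfl⟩
    rw [normalForm_toWord hd, decode_some]
  · intro h
    rcases hd : normalForm (w : W₀) with _ | d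
    · rw [hd] at h; exact absurd h.symm WithZero.coe_ne_zero
    · rw [hd] at h; exact ⟨d, sorted_of_normalForm hd, WithZero.coe_injective h⟩

theorem rewritingMeasure_le {w w' : W₀} (h : w ⟶* w') :
    rewritingMeasure w' ≤ rewritingMeasure w := by
  induction h with
  | refl => exact le_rfl
  | tail _ hs ih => exact (rewritingMeasure_lt hs).le.trans ih

/-- An irreducible word equals its normal form since it rewrites to it. Conversely, if a normal word
`w` had a step to `w'`, then `w'` would rewrite back to the common normal form `w`, against the
decrease of the measure. -/
theorem irreducibleWords_eq : ruleSetInf.irreducibleWords = normalWords := by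
  ext w
  constructor
  · intro h
    rw [mem_normalWords_iff_decode]
    rcases (red_normalForm (w : W₀)).cases_head with h' | ⟨w', h', -⟩
    · exact h'.symm
    · exact absurd h' (h w')
  · intro h w' hs
    rw [mem_normalWords_iff_decode] at h
    have h1 : w' ⟶* (w : W₀) := by
      have := red_normalForm w'
      rwa [← normalForm_eq_of_red (.single hs), h] at this
    exact (rewritingMeasure_lt hs).not_ge (rewritingMeasure_le h1)

/-- Rules between words are homogeneous, so length can only be lost by reaching zero. This makes the
basis of normal words compatible with the grading. -/
theorem red_length {w w' : W} {y z : W₀} (h : y ⟶* z) (hy : y = (w : W₀)) (hz : z = (w' : W₀)) :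
    w'.length = w.length := by
  induction h generalizing w' with
  | refl => rw [WithZero.coe_injective (hz.symm.trans hy)]
  | tail _ hs ih =>
    obtain ⟨x, y, u, v, hr, rfl, rfl⟩ := hs
    induction v using WithZero.recZeroCoe with
    | zero => simp at hz
    | coe v =>
      rw [← ih rfl]
      rw [← coe_mul_word, ← coe_mul_word] at hz
      rw [← WithZero.coe_injective hz]
      have : v.length = u.length := by
        rcases hr with hr | ⟨n, hr⟩
        · simp only [Set.mem_insert_iff, Set.mem_singleton_iff, Prod.mk.injEq,
            WithZero.coe_ne_zero, and_false, or_false, WithZero.coe_inj] at hr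
          rcases hr with ⟨rfl, rfl⟩ | ⟨rfl, rfl⟩ <;> rfl
        · exact absurd (Prod.mk.inj hr).2 WithZero.coe_ne_zero
      simp [FreeMonoid.length_mul, this]

theorem length_toWord_normalForm {w : W} {d : NormalForm} (h : normalForm (w : W₀) = some d) :
    d.toWord.length = w.length :=
  red_length (red_normalForm (w : W₀)) rfl (by rw [h, decode_some])

end NormalWords

end KobayashiAlgebra

namespace KobayashiAlgebra

/-! ### Monomials in free algebras and homogeneous components. -/

section FreeAlg

variable (k : Type*) [Field k]

theorem span_range_lift_ι (X : Type*) :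
    Submodule.span k (Set.range (FreeMonoid.lift (FreeAlgebra.ι k : X → FreeAlgebra k X))) = ⊤ := by
  have h := congrArg Subalgebra.toSubmodule (FreeAlgebra.adjoin_range_ι k X)
  rw [Algebra.adjoin_eq_span, ← FreeMonoid.mrange_lift, MonoidHom.coe_mrange] at h
  simpa using h

theorem component_eq_span {B : Type*} [Ring B] [Algebra k B] {X : Type*} (x : X → B) (n : ℕ) :
    component k x n = Submodule.span k (FreeMonoid.lift x '' {w | w.length = n}) := by
  unfold component
  congr 1
  ext y
  constructor
  · rintro ⟨l, hl, rfl⟩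
    exact ⟨FreeMonoid.ofList l, hl, by rw [FreeMonoid.lift_apply]; rfl⟩
  · rintro ⟨w, hw, rfl⟩
    exact ⟨w.toList, hw, by rw [FreeMonoid.lift_apply]⟩

theorem mem_of_ringCon_mk_eq_zero {R : Type*} [Ring R] (I : TwoSidedIdeal R) {x : R}
    (h : (x : I.ringCon.Quotient) = 0) : x ∈ I :=
  (TwoSidedIdeal.mem_iff I x).2 (Quotient.exact' h)

end FreeAlg

/-! ### The ideal of relations, the basis and the grading of `A`. -/

section Algebra

open NormalForm

variable (k : Type*) [Field k]

local notation "W" => FreeMonoid Letter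
local notation "W₀" => WithZero (FreeMonoid Letter)

@[simp] theorem monomialOf_coe (w : W) :
    monomialOf k (w : W₀) = FreeMonoid.lift (FreeAlgebra.ι k) w := rfl

theorem monomialOf_wa : FreeMonoid.lift (FreeAlgebra.ι k) wa = FreeAlgebra.ι k Letter.a := by
  rw [wa, FreeMonoid.lift_eval_of]
theorem monomialOf_wb : FreeMonoid.lift (FreeAlgebra.ι k) wb = FreeAlgebra.ι k Letter.b := by
  rw [wb, FreeMonoid.lift_eval_of]
theorem monomialOf_wc : FreeMonoid.lift (FreeAlgebra.ι k) wc = FreeAlgebra.ι k Letter.c := by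
  rw [wc, FreeMonoid.lift_eval_of]

/-- The element of `A` represented by a word or zero. -/
noncomputable def image (w : W₀) : A k := proj k (monomialOf k w)

theorem image_coe (w : W) : image k (w : W₀) = wordImage k w := rfl
@[simp] theorem image_zero : image k 0 = 0 := by simp [image]
theorem image_mul (u v : W₀) : image k (u * v) = image k u * image k v := by simp [image]

theorem wordImage_mul (u v : W) : wordImage k (u * v) = wordImage k u * wordImage k v :=
  image_mul k u v

@[simp] theorem wordImage_one : wordImage k 1 = 1 := by simp [wordImage]
theorem wordImage_of (x : Letter) : wordImage k (FreeMonoid.of x) = gen k x := by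
  simp [wordImage, gen]

theorem wordImage_eq_lift (w : W) : wordImage k w = FreeMonoid.lift (gen k) w := by
  induction w using FreeMonoid.inductionOn' with
  | one => simp
  | of_mul x w ih => rw [wordImage_mul, ih, wordImage_of, map_mul, FreeMonoid.lift_eval_of]

/-- The relations of `A` are those of `ruleSet`. -/
theorem rel_iff (f g : FreeAlgebra k Letter) :
    Rel k f g ↔ ∃ p ∈ ruleSet, f = monomialOf k (p.1 : W₀) ∧ g = monomialOf k p.2 := by
  constructor
  · rintro (_ | _ | _ | _ | _ | _ | _)
    · exact ⟨_, mem_ruleSet_bba, by simp [monomialOf_wa, monomialOf_wb, pow_two, mul_assoc]⟩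
    · exact ⟨_, mem_ruleSet_bbc, by
        simp [monomialOf_wa, monomialOf_wb, monomialOf_wc, pow_two]⟩
    · exact ⟨(wa * wc * wc, 0), by simp [ruleSet], by simp [monomialOf_wa, monomialOf_wc]⟩
    · exact ⟨(wa * wb * wa, 0), by simp [ruleSet], by simp [monomialOf_wa, monomialOf_wb]⟩
    · exact ⟨(wa * wb * wc, 0), by simp [ruleSet], by
        simp [monomialOf_wa, monomialOf_wb, monomialOf_wc]⟩
    · exact ⟨(wc * wb * wa, 0), by simp [ruleSet], by
        simp [monomialOf_wa, monomialOf_wb, monomialOf_wc]⟩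
    · exact ⟨(wc * wb * wc, 0), by simp [ruleSet], by simp [monomialOf_wb, monomialOf_wc]⟩
  · rintro ⟨⟨u, v⟩, h, rfl, rfl⟩
    simp only [ruleSet, Set.mem_insert_iff, Set.mem_singleton_iff, Prod.mk.injEq] at h
    rcases h with ⟨rfl, rfl⟩ | ⟨rfl, rfl⟩ | ⟨rfl, rfl⟩ | ⟨rfl, rfl⟩ | ⟨rfl, rfl⟩ | ⟨rfl, rfl⟩ |
      ⟨rfl, rfl⟩
    · simpa [monomialOf_wa, monomialOf_wb, pow_two, mul_assoc] using Rel.bba (k := k)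
    · simpa [monomialOf_wa, monomialOf_wb, monomialOf_wc, pow_two] using Rel.bbc (k := k)
    · simpa [monomialOf_wa, monomialOf_wb, monomialOf_wc, pow_two] using Rel.acc (k := k)
    · simpa [monomialOf_wa, monomialOf_wb, monomialOf_wc, pow_two] using Rel.aba (k := k)
    · simpa [monomialOf_wa, monomialOf_wb, monomialOf_wc, pow_two] using Rel.abc (k := k)
    · simpa [monomialOf_wa, monomialOf_wb, monomialOf_wc, pow_two] using Rel.cba (k := k)
    · simpa [monomialOf_wa, monomialOf_wb, monomialOf_wc, pow_two] using Rel.cbc (k := k)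

theorem image_eq_of_eqvGen {w w' : W₀} (h : Relation.EqvGen ruleSet.Step w w') :
    image k w = image k w' := by
  induction h with
  | rel _ _ hs =>
    obtain ⟨x, y, u, v, hr, rfl, rfl⟩ := hs
    have : image k (u : W₀) = image k v :=
      RingQuot.mkAlgHom_rel k ((rel_iff k _ _).2 ⟨_, hr, rfl, rfl⟩)
    simp only [coe_mul_word, image_mul, this]
  | refl => rfl
  | symm _ _ _ ih => exact ih.symm
  | trans _ _ _ _ _ ih₁ ih₂ => exact ih₁.trans ih₂

theorem image_normalForm (w : W₀) : image k (decode (normalForm w)) = image k w :=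
  (image_eq_of_eqvGen k (eqvGen_normalForm w)).symm

/-- In the quotient by the relators of `ruleSetInf` the congruence generated by that system becomes
equality; by equivalence the seven relations hold there, so the quotient map factors through `A`. -/
theorem ker_proj :
    TwoSidedIdeal.ker (proj k) = TwoSidedIdeal.span (ruleSetInf.relators k) := by
  set I := TwoSidedIdeal.span (ruleSetInf.relators k) with hI
  apply le_antisymm
  · intro x hx
    rw [TwoSidedIdeal.mem_ker] at hx
    let q : FreeAlgebra k Letter →ₐ[k] I.ringCon.Quotient := I.ringCon.mkₐ k
    have hq0 : ∀ p ∈ ruleSetInf, q (monomialOf k (p.1 : W₀)) = q (monomialOf k p.2) :=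
      fun p hp => (RingCon.eq I.ringCon).2
        ((TwoSidedIdeal.rel_iff I _ _).2 (TwoSidedIdeal.subset_span ⟨p, hp, rfl⟩))
    have hq1 : ∀ w w' : W₀, Relation.EqvGen ruleSetInf.Step w w' →
        q (monomialOf k w) = q (monomialOf k w') := by
      intro w w' h
      induction h with
      | rel _ _ hs =>
        obtain ⟨x, y, u, v, hr, rfl, rfl⟩ := hs
        simp only [coe_mul_word, map_mul, hq0 _ hr]
      | refl => rfl
      | symm _ _ _ ih => exact ih.symm
      | trans _ _ _ _ _ ih₁ ih₂ => exact ih₁.trans ih₂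
    have hq : ∀ ⦃f g⦄, Rel k f g → q f = q g := by
      intro f g h
      obtain ⟨⟨u, v⟩, hp, rfl, rfl⟩ := (rel_iff k f g).1 h
      exact hq1 _ _ ((ruleSetInf_isEquivalent _ _).2 (.rel _ _ (.of_mem hp)))
    have h := RingQuot.liftAlgHom_mkAlgHom_apply k q hq x
    rw [hx, map_zero] at h
    exact mem_of_ringCon_mk_eq_zero I h.symm
  · rw [TwoSidedIdeal.span_le]
    rintro _ ⟨⟨u, v⟩, hp, rfl⟩
    rw [SetLike.mem_coe, TwoSidedIdeal.mem_ker, map_sub, sub_eq_zero]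
    exact image_eq_of_eqvGen k ((ruleSetInf_isEquivalent _ _).1 (.rel _ _ (.of_mem hp)))

/-! ### The regular representation on normal forms -/

/-- The vector of a normal form or zero. -/
noncomputable def vec : Option NormalForm → NormalForm →₀ k
  | none => 0
  | some d => Finsupp.single d 1

/-- The operator of a letter. -/
noncomputable def letterOp (x : Letter) : Module.End k (NormalForm →₀ k) :=
  Finsupp.linearCombination k fun d => vec k (act x d)

theorem letterOp_vec (x : Letter) (o : Option NormalForm) :
    letterOp k x (vec k o) = vec k (o.bind (act x)) := by
  rcases o with _ | d
  · simp [vec]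
  · simp [vec, letterOp]

theorem lift_letterOp_vec (w : W₀) (o : Option NormalForm) :
    FreeAlgebra.lift k (letterOp k) (monomialOf k w) (vec k o) = vec k (runZero w o) := by
  induction w using WithZero.recZeroCoe with
  | zero => simp [vec]
  | coe w =>
    rw [runZero_coe, monomialOf_coe]
    induction w using FreeMonoid.inductionOn' with
    | one => simp
    | of_mul x w ih =>
      rw [map_mul, map_mul, Module.End.mul_apply, ih, FreeMonoid.lift_eval_of,
        FreeAlgebra.lift_ι_apply, letterOp_vec, run_mul, run_of]

/-- The representation of `A` on the vector space with basis the normal forms. -/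
noncomputable def rep : A k →ₐ[k] Module.End k (NormalForm →₀ k) :=
  RingQuot.liftAlgHom k ⟨FreeAlgebra.lift k (letterOp k), by
    intro f g h
    obtain ⟨⟨u, v⟩, hp, rfl, rfl⟩ := (rel_iff k f g).1 h
    refine Finsupp.lhom_ext' fun d => LinearMap.ext_ring ?_
    have h1 := lift_letterOp_vec k (u : W₀) (some d)
    rw [runZero_coe, runZero_eq_of_mem_ruleSet hp, ← lift_letterOp_vec] at h1
    exact h1⟩

/-- The coordinates of an element of `A` with respect to the normal forms. -/
noncomputable def coords : A k →ₗ[k] NormalForm →₀ k :=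
  (LinearMap.applyₗ (vec k (some (pow 0)))).comp (rep k).toLinearMap

theorem coords_image (w : W₀) : coords k (image k w) = vec k (normalForm w) := by
  rw [normalForm, ← lift_letterOp_vec]
  change rep k (proj k _) _ = _
  rw [rep, RingQuot.liftAlgHom_mkAlgHom_apply]

/-- `coords` evaluates the representation at the vector of the empty word, and so sends distinct
normal words to distinct basis vectors. -/
theorem linearIndepOn_normalWords : LinearIndepOn k (wordImage k) normalWords := by
  have hN : ∀ w : normalWords, ∃ d, normalForm ((w : W) : W₀) = some d ∧ d.toWord = w := by
    rintro ⟨w, hw⟩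
    obtain ⟨d, hd, rfl⟩ := mem_normalWords_iff.1 hw
    exact ⟨d, normalForm_toWord hd, rfl⟩
  choose f hf hf' using hN
  refine LinearIndependent.of_comp (coords k) ?_
  have hinj : Function.Injective f := fun u v h => Subtype.ext (by rw [← hf' u, ← hf' v, h])
  convert (Finsupp.basisSingleOne (R := k) (ι := NormalForm)).linearIndependent.comp f hinj using 1
  ext1 w
  rw [Function.comp_apply, ← image_coe, coords_image, hf]
  simp [vec]

theorem image_mem_span {s : Set W} {w : W}
    (h : ∀ d, normalForm (w : W₀) = some d → d.toWord ∈ s) :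
    wordImage k w ∈ Submodule.span k (wordImage k '' s) := by
  rw [← image_coe, ← image_normalForm]
  rcases hd : normalForm (w : W₀) with _ | d
  · simp
  · exact Submodule.subset_span ⟨_, h d hd, rfl⟩

theorem component_gen (n : ℕ) :
    component k (gen k) n =
      Submodule.span k (wordImage k '' {w | w ∈ normalWords ∧ w.length = n}) := by
  have h0 : component k (gen k) n = Submodule.span k (wordImage k '' {w | w.length = n}) := by
    rw [component_eq_span]
    simp only [← wordImage_eq_lift]
  rw [h0]
  apply le_antisymm
  · rw [Submodule.span_le]
    rintro _ ⟨w, hw, rfl⟩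
    refine image_mem_span k fun d hd =>
      ⟨mem_normalWords_iff.2 ⟨d, sorted_of_normalForm hd, rfl⟩, ?_⟩
    rw [length_toWord_normalForm hd]; exact hw
  · exact Submodule.span_mono (Set.image_mono fun w hw => hw.2)

theorem wordImage_mem_component (w : W) : wordImage k w ∈ component k (gen k) w.length := by
  rw [wordImage_eq_lift, component_eq_span]
  exact Submodule.subset_span ⟨w, rfl, rfl⟩

theorem span_range_wordImage : Submodule.span k (Set.range (wordImage k)) = ⊤ := by
  have h := congrArg (Submodule.map (proj k).toLinearMap) (span_range_lift_ι k Letter)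
  rw [Submodule.map_span, ← Set.range_comp, Submodule.map_top,
    LinearMap.range_eq_top.2 (RingQuot.mkAlgHom_surjective k (Rel k))] at h
  exact h

theorem span_normalWords : Submodule.span k (wordImage k '' normalWords) = ⊤ := by
  rw [← top_le_iff, ← span_range_wordImage, Submodule.span_le]
  rintro _ ⟨w, rfl⟩
  exact image_mem_span k fun d hd => mem_normalWords_iff.2 ⟨d, sorted_of_normalForm hd, rfl⟩

/-- The components are spanned by disjoint parts of the basis of normal words. -/
theorem isInternal_component : DirectSum.IsInternal (component k (gen k)) := by
  apply DirectSum.isInternal_submodule_of_iSupIndep_of_iSup_eq_top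
  · intro n
    have hle : (⨆ (m : ℕ) (_ : m ≠ n), component k (gen k) m) ≤
        Submodule.span k (wordImage k '' {w | w ∈ normalWords ∧ w.length ≠ n}) := by
      refine iSup₂_le fun m hm => ?_
      rw [component_gen]
      exact Submodule.span_mono (Set.image_mono fun w hw => ⟨hw.1, hw.2.trans_ne hm⟩)
    refine Disjoint.mono_right hle ?_
    rw [component_gen]
    have hd : Disjoint {w : W | w ∈ normalWords ∧ w.length = n}
        {w | w ∈ normalWords ∧ w.length ≠ n} :=
      Set.disjoint_left.2 fun w h1 h2 => h2.2 h1.2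
    exact ((linearIndepOn_union_iff hd).1 ((linearIndepOn_normalWords k).mono
      (Set.union_subset (fun _ h => h.1) fun _ h => h.1))).2.2
  · rw [← top_le_iff, ← span_range_wordImage, Submodule.span_le]
    rintro _ ⟨w, rfl⟩
    exact Submodule.mem_iSup_of_mem _ (wordImage_mem_component k w)

theorem finrank_span_normalWords {s : Set W} (hs : s ⊆ normalWords) (hfin : s.Finite) :
    Module.finrank k (Submodule.span k (wordImage k '' s)) = s.ncard := by
  have hl := (linearIndepOn_normalWords k).mono hs
  have := (hfin.image (wordImage k)).fintype
  rw [finrank_span_set_eq_card hl.id_image, ← Set.ncard_eq_toFinset_card',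
    hl.injOn.ncard_image]

end Algebra

end KobayashiAlgebra

namespace KobayashiAlgebra

/-! ### Growth functions and their independence of the generating set. -/

section Growth

open Filter

theorem GrowthLE.trans {f g h : ℕ → ℝ} (hfg : GrowthLE f g) (hgh : GrowthLE g h) :
    GrowthLE f h := by
  obtain ⟨N, C, hN, hC, h₁⟩ := hfg
  obtain ⟨M, D, -, hD, h₂⟩ := hgh
  refine ⟨max N M, D * C, lt_max_of_lt_left hN, Nat.mul_pos hD hC, fun n hn => ?_⟩
  have h := h₂ (C * n) ((le_of_max_le_right hn).trans (Nat.le_mul_of_pos_left n hC))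
  rw [← mul_assoc] at h
  exact (h₁ n (le_of_max_le_left hn)).trans h

theorem GrowthEquiv.trans {f g h : ℕ → ℝ} (hfg : GrowthEquiv f g) (hgh : GrowthEquiv g h) :
    GrowthEquiv f h :=
  ⟨hfg.1.trans hgh.1, hgh.2.trans hfg.2⟩

theorem GrowthEquiv.symm {f g : ℕ → ℝ} (h : GrowthEquiv f g) : GrowthEquiv g f := ⟨h.2, h.1⟩

variable (k : Type*) [Field k] {B : Type*} [Ring B] [Algebra k B]

/-- The span of `1` and a set of elements. -/
def unitSpan (S : Set B) : Submodule k B := Submodule.span k (insert 1 S)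

theorem one_le_unitSpan (S : Set B) : 1 ≤ unitSpan k S := by
  rw [Submodule.one_le]
  exact Submodule.subset_span (Set.mem_insert _ _)

theorem unitSpan_pow_mono (S : Set B) : Monotone fun n => unitSpan k S ^ n :=
  fun _ _ h => pow_le_pow_right' (one_le_unitSpan k S) h

theorem finite_unitSpan_pow (S : Finset B) (n : ℕ) :
    Module.Finite k (unitSpan k (S : Set B) ^ n : Submodule k B) := by
  rw [Module.Finite.iff_fg]
  exact Submodule.FG.pow (Submodule.fg_span (S.finite_toSet.insert 1)) n

open scoped Pointwise in
-- Padding with `1` turns "at most `n` factors" into "exactly `n` factors", so that growth functions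
-- become dimensions of powers of one subspace.
theorem setOf_prod_eq_insert_one_pow (S : Finset B) (n : ℕ) :
    {x : B | ∃ l : List B, (∀ y ∈ l, y ∈ S) ∧ l.length ≤ n ∧ l.prod = x} =
      (insert 1 (S : Set B)) ^ n := by
  induction n with
  | zero =>
    ext x
    simp only [nonpos_iff_eq_zero, List.length_eq_zero_iff, Set.mem_ofPred_eq, pow_zero,
      Set.mem_one]
    constructor
    · rintro ⟨l, -, rfl, rfl⟩; rfl
    · rintro rfl; exact ⟨[], by simp⟩
  | succ n ih =>
    rw [pow_succ', ← ih]
    ext x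
    rw [Set.mem_mul]
    constructor
    · rintro ⟨l, hl, hn, rfl⟩
      rcases l with _ | ⟨y, l⟩
      · exact ⟨1, Set.mem_insert _ _, 1, ⟨[], by simp⟩, by simp⟩
      · exact ⟨y, Set.mem_insert_of_mem _ (hl y (by simp)), l.prod,
          ⟨l, fun z hz => hl z (List.mem_cons_of_mem _ hz), by simpa using hn, rfl⟩, by simp⟩
    · rintro ⟨y, rfl | hy, _, ⟨l, hl, hn, rfl⟩, rfl⟩
      · exact ⟨l, hl, by omega, by simp⟩
      · refine ⟨y :: l, ?_, by simpa using hn, by simp⟩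
        rintro z (_ | ⟨_, hz⟩)
        · exact hy
        · exact hl _ hz

theorem growthFunction_eq (S : Finset B) (n : ℕ) :
    growthFunction k S n = Module.finrank k (unitSpan k (S : Set B) ^ n : Submodule k B) := by
  rw [growthFunction, setOf_prod_eq_insert_one_pow, unitSpan, Submodule.span_pow]

theorem growthFunction_mono (S : Finset B) : Monotone (growthFunction k S) := by
  intro m n h
  rw [growthFunction_eq, growthFunction_eq]
  have := finite_unitSpan_pow k S n
  exact Submodule.finrank_mono (unitSpan_pow_mono k _ h)

theorem exists_mem_unitSpan_pow {S : Set B} (h : Algebra.adjoin k S = ⊤) (x : B) :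
    ∃ n, x ∈ unitSpan k S ^ n := by
  have hx : x ∈ Algebra.adjoin k S := h ▸ Algebra.mem_top
  induction hx using Algebra.adjoin_induction with
  | mem x hx => exact ⟨1, by rw [pow_one]; exact Submodule.subset_span (Set.mem_insert_of_mem _ hx)⟩
  | algebraMap r => exact ⟨0, by rw [pow_zero]; exact Submodule.mem_one.2 ⟨r, rfl⟩⟩
  | add x y _ _ hx hy =>
    obtain ⟨m, hm⟩ := hx
    obtain ⟨n, hn⟩ := hy
    exact ⟨max m n, Submodule.add_mem _ (unitSpan_pow_mono k S (le_max_left m n) hm)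
      (unitSpan_pow_mono k S (le_max_right m n) hn)⟩
  | mul x y _ _ hx hy =>
    obtain ⟨m, hm⟩ := hx
    obtain ⟨n, hn⟩ := hy
    exact ⟨m + n, by rw [pow_add]; exact Submodule.mul_mem_mul hm hn⟩

theorem exists_unitSpan_le (S : Finset B) {T : Set B} (h : Algebra.adjoin k T = ⊤) :
    ∃ C, 0 < C ∧ unitSpan k (S : Set B) ≤ unitSpan k T ^ C := by
  choose f hf using exists_mem_unitSpan_pow k h
  -- The extra `1` keeps the constant positive, as `GrowthLE` demands.
  refine ⟨S.sup f + 1, Nat.succ_pos _, ?_⟩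
  refine Submodule.span_le.2 (Set.insert_subset ?_ fun x hx => ?_)
  · exact unitSpan_pow_mono k T (Nat.zero_le _) (by
      beta_reduce; rw [pow_zero]; exact Submodule.one_le.1 le_rfl)
  · exact unitSpan_pow_mono k T ((Finset.le_sup (f := f) hx).trans (Nat.le_succ _)) (hf x)

/-- The span of `1` and `S` lies in some `C`-th power of the span of `1` and `T`; take `n`-th
powers. -/
theorem growthFunction_growthLE (S : Finset B) {T : Finset B}
    (h : Algebra.adjoin k (T : Set B) = ⊤) :
    GrowthLE (fun n => (growthFunction k S n : ℝ)) (fun n => (growthFunction k T n : ℝ)) := by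
  obtain ⟨C, hC, hle⟩ := exists_unitSpan_le k S h
  refine ⟨1, C, one_pos, hC, fun n _ => ?_⟩
  have := finite_unitSpan_pow k T (C * n)
  beta_reduce
  rw [growthFunction_eq, growthFunction_eq, Nat.cast_le]
  refine Submodule.finrank_mono ?_
  rw [pow_mul]
  exact pow_le_pow_left' hle n

theorem hasGrowthType_of_growthEquiv {S : Finset B} (hS : Algebra.adjoin k (S : Set B) = ⊤)
    {f : ℕ → ℝ} (h : GrowthEquiv (fun n => (growthFunction k S n : ℝ)) f) :
    HasGrowthType k B f :=
  ⟨⟨S, hS⟩, fun _ hT => GrowthEquiv.trans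
    ⟨growthFunction_growthLE k _ hS, growthFunction_growthLE k _ hT⟩ h⟩

variable {k} in
theorem HasGrowthType.trans {f g : ℕ → ℝ} (h : HasGrowthType k B f) (hfg : GrowthEquiv f g) :
    HasGrowthType k B g :=
  ⟨h.1, fun S hS => (h.2 S hS).trans hfg⟩

theorem isLittleO_pow_exp_sqrt (d : ℕ) :
    (fun n : ℕ => (n : ℝ) ^ d) =o[atTop] fun n : ℕ => Real.exp (Real.sqrt n) := by
  have h : Tendsto (fun n : ℕ => Real.sqrt n) atTop atTop :=
    Real.tendsto_sqrt_atTop.comp tendsto_natCast_atTop_atTop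
  refine ((Real.isLittleO_pow_exp_atTop (n := 2 * d)).comp_tendsto h).congr_left fun n => ?_
  simp [pow_mul]

/-- The difference of the exponents is `√n (log c · √n - √C)`, which tends to infinity. -/
theorem isLittleO_exp_sqrt_pow (C : ℕ) {c : ℝ} (hc : 1 < c) :
    (fun n : ℕ => Real.exp (Real.sqrt ((C * n : ℕ) : ℝ))) =o[atTop] fun n : ℕ => c ^ n := by
  have hl : 0 < Real.log c := Real.log_pos hc
  have hs : Tendsto (fun n : ℕ => Real.sqrt n) atTop atTop :=
    Real.tendsto_sqrt_atTop.comp tendsto_natCast_atTop_atTop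
  have h : Tendsto (fun n : ℕ => Real.log c * n - Real.sqrt ((C * n : ℕ) : ℝ)) atTop atTop := by
    have h1 : Tendsto (fun n : ℕ => Real.sqrt n * (Real.log c * Real.sqrt n - Real.sqrt C))
        atTop atTop :=
      hs.atTop_mul_atTop₀ (tendsto_atTop_add_const_right _ _ (hs.const_mul_atTop hl))
    refine h1.congr fun n => ?_
    rw [Nat.cast_mul, Real.sqrt_mul (Nat.cast_nonneg C)]
    have := Real.mul_self_sqrt (Nat.cast_nonneg (α := ℝ) n)
    linear_combination Real.log c * this
  refine (Real.isLittleO_exp_comp_exp_comp.2 h).congr_right fun n => ?_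
  rw [mul_comm, Real.exp_nat_mul, Real.exp_log (by linarith)]

variable {k} in
theorem HasGrowthType.hasIntermediateGrowth
    (h : HasGrowthType k B fun n => Real.exp (Real.sqrt (n : ℝ))) : HasIntermediateGrowth k B := by
  refine ⟨h.1, fun S hS => ⟨fun d => ?_, fun c hc => ?_⟩⟩
  · obtain ⟨N, C, hN, hC, hle⟩ := (h.2 S hS).2
    -- The lower bound controls the growth function only at multiples of `C`. It is applied at `C
    -- ⌊n/C⌋ ≤ n`, and `n ≤ 2C ⌊n/C⌋` once `⌊n/C⌋ ≥ 1`.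
    have ht : Tendsto (fun n : ℕ => n / C) atTop atTop := Nat.tendsto_div_const_atTop hC.ne'
    have h1 := (isLittleO_pow_exp_sqrt d).comp_tendsto ht
    have h2 : (fun n : ℕ => (n : ℝ) ^ d) =O[atTop] fun n : ℕ => ((n / C : ℕ) : ℝ) ^ d := by
      refine Asymptotics.IsBigO.pow (Asymptotics.IsBigO.of_bound (2 * C) ?_) d
      filter_upwards [ht.eventually_ge_atTop 1] with n hn
      simp only [RCLike.norm_natCast]
      have h3 : n < C * (n / C) + C := Nat.lt_mul_div_succ n hC
      have h4 : C ≤ C * (n / C) := Nat.le_mul_of_pos_right C hn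
      have : n ≤ 2 * C * (n / C) := by rw [mul_assoc]; omega
      exact_mod_cast this
    have h3 : (fun n : ℕ => Real.exp (Real.sqrt ((n / C : ℕ) : ℝ))) =O[atTop]
        fun n : ℕ => (growthFunction k S n : ℝ) := by
      refine Asymptotics.IsBigO.of_bound 1 ?_
      filter_upwards [ht.eventually_ge_atTop N] with n hn
      rw [Real.norm_of_nonneg (Real.exp_nonneg _), RCLike.norm_natCast, one_mul]
      refine (hle (n / C) hn).trans (Nat.cast_le.2 (growthFunction_mono k S ?_))
      exact Nat.mul_div_le n C
    exact (h2.trans_isLittleO h1).trans_isBigO h3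
  · obtain ⟨N, C, hN, hC, hle⟩ := (h.2 S hS).1
    refine Asymptotics.IsBigO.trans_isLittleO ?_ (isLittleO_exp_sqrt_pow C hc)
    refine Asymptotics.IsBigO.of_bound 1 ?_
    filter_upwards [eventually_ge_atTop N] with n hn
    rw [Real.norm_of_nonneg (Real.exp_nonneg _), RCLike.norm_natCast, one_mul]
    exact hle n hn

end Growth

end KobayashiAlgebra

namespace KobayashiAlgebra

/-! ### Elementary bounds for the partition function. -/

section Partitions

/-- A weighted count of partitions is bounded by a truncated Euler product. -/
theorem partitionCount_mul_pow_le {x : ℝ} (hx : 0 ≤ x) (n : ℕ) :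
    partitionCount n * x ^ n ≤
      ∏ j ∈ Finset.range n, ∑ c ∈ Finset.range (n + 1), (x ^ (j + 1)) ^ c := by
  classical
  rw [← Finset.prod_coe_sort]
  rw [Finset.prod_univ_sum]
  -- A partition is recorded by the multiplicities of its parts `1, …, n`, each at most `n`. It then
  -- corresponds to one term of weight `x ^ n` in the expanded product.
  let F : n.Partition → (Finset.range n → ℕ) := fun p j => p.parts.count (j.1 + 1)
  have hsum : ∀ p : n.Partition, ∑ j : Finset.range n, (j.1 + 1) * F p j = n := by
    intro p
    have h0 : ∑ j : Finset.range n, (j.1 + 1) * F p j =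
        ∑ j ∈ Finset.range n, (j + 1) * p.parts.count (j + 1) :=
      Finset.sum_coe_sort (Finset.range n) fun j => (j + 1) * p.parts.count (j + 1)
    have h1 : ∑ j ∈ Finset.range (n + 1), p.parts.count j • j = p.parts.sum := by
      rw [Finset.sum_multiset_count_of_subset]
      intro j hj
      rw [Finset.mem_range]
      exact Nat.lt_succ_of_le (p.le_of_mem_parts (Multiset.mem_toFinset.1 hj))
    rw [p.parts_sum, Finset.sum_range_succ'] at h1
    rw [h0]
    refine Eq.trans ?_ h1
    simp [mul_comm]
  have hF : Function.Injective F := by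
    intro p q h
    apply Nat.Partition.ext
    ext j
    rcases j with _ | j
    · rw [Multiset.count_eq_zero_of_notMem fun h => (p.parts_pos h).ne rfl,
        Multiset.count_eq_zero_of_notMem fun h => (q.parts_pos h).ne rfl]
    · by_cases hj : j < n
      · exact congrFun h ⟨j, Finset.mem_range.2 hj⟩
      · rw [Multiset.count_eq_zero_of_notMem fun h => hj (p.le_of_mem_parts h),
          Multiset.count_eq_zero_of_notMem fun h => hj (q.le_of_mem_parts h)]
  have hw : ∀ p : n.Partition, ∏ j : Finset.range n, (x ^ (j.1 + 1)) ^ F p j = x ^ n := by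
    intro p
    simp_rw [← pow_mul]
    rw [Finset.prod_pow_eq_pow_sum, hsum]
  calc (partitionCount n : ℝ) * x ^ n
      = ∑ f ∈ Finset.univ.image F, ∏ j : Finset.range n, (x ^ (j.1 + 1)) ^ f j := by
        rw [Finset.sum_image fun p _ q _ h => hF h]
        simp_rw [hw]
        simp [partitionCount]
    _ ≤ _ := by
        refine Finset.sum_le_sum_of_subset_of_nonneg ?_ fun _ _ _ => by positivity
        intro f hf
        obtain ⟨p, -, rfl⟩ := Finset.mem_image.1 hf
        rw [Fintype.mem_piFinset]
        intro j
        rw [Finset.mem_range]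
        have h1 := Finset.single_le_sum (f := fun j : Finset.range n => (j.1 + 1) * F p j)
          (fun _ _ => Nat.zero_le _) (Finset.mem_univ j)
        rw [hsum] at h1
        have h2 : F p j ≤ (j.1 + 1) * F p j := Nat.le_mul_of_pos_left _ (Nat.succ_pos _)
        exact Nat.lt_succ_of_le (h2.trans h1)

theorem sum_geom_le_inv {y : ℝ} (hy : 0 ≤ y) (hy1 : y < 1) (n : ℕ) :
    ∑ c ∈ Finset.range n, y ^ c ≤ (1 - y)⁻¹ := by
  rw [← tsum_geometric_of_lt_one hy hy1]
  exact (summable_geometric_of_lt_one hy hy1).sum_le_tsum _ fun _ _ => pow_nonneg hy _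

/-- With `x = s / (s + 1)` the first `s` factors of the Euler product contribute at most `4 ^ s`. -/
theorem inv_one_sub_pow_le {s : ℕ} (hs : 0 < s) (j : ℕ) (hj : 0 < j) :
    (1 - ((s : ℝ) / (s + 1)) ^ j)⁻¹ ≤ 1 + s / j := by
  have hs' : (0 : ℝ) < s := Nat.cast_pos.2 hs
  have hj' : (0 : ℝ) < j := Nat.cast_pos.2 hj
  -- Bernoulli's inequality for the `j`-th power of `x⁻¹ = 1 + 1 / s`.
  have hb := one_add_mul_le_pow (a := 1 / (s : ℝ)) (by have : 0 < 1 / (s : ℝ) := by positivity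
                                                       linarith) j
  have hx : ((s : ℝ) / (s + 1)) ^ j = ((1 + 1 / (s : ℝ)) ^ j)⁻¹ := by
    rw [← inv_pow]; congr 1; field_simp
  set y := (1 + 1 / (s : ℝ)) ^ j with hy
  have hpos : 0 < (j : ℝ) * (1 / s) := by positivity
  have hy1 : 1 < y := by linarith
  have h1 : y⁻¹ ≤ (1 + j * (1 / (s : ℝ)))⁻¹ := inv_anti₀ (by linarith) hb
  rw [hx]
  calc (1 - y⁻¹)⁻¹ ≤ (1 - (1 + j * (1 / (s : ℝ)))⁻¹)⁻¹ := by
        refine inv_anti₀ ?_ (by linarith)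
        rw [sub_pos]
        exact inv_lt_one_of_one_lt₀ (by linarith)
    _ = 1 + s / j := by
      have h2 : 1 - (1 + j * (1 / (s : ℝ)))⁻¹ = j * (1 / s) / (1 + j * (1 / s)) := by
        have : 1 + j * (1 / (s : ℝ)) ≠ 0 := by positivity
        rw [eq_div_iff this, sub_mul, inv_mul_cancel₀ this]
        ring
      rw [h2, inv_div, add_div, div_self hpos.ne']
      field_simp
      ring

/-- The product equals the binomial coefficient `(s + m).choose m`, which is at most `2 ^ (s + m)`.
-/
theorem prod_one_add_div_le (s m : ℕ) (hm : m ≤ s) :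
    ∏ j ∈ Finset.range m, (1 + (s : ℝ) / ((j + 1 : ℕ) : ℝ)) ≤ 4 ^ s := by
  have h : ∏ j ∈ Finset.range m, (1 + (s : ℝ) / ((j + 1 : ℕ) : ℝ)) = (s + m).choose m := by
    clear hm
    induction m with
    | zero => simp
    | succ m ih =>
      rw [Finset.prod_range_succ, ih]
      have h1 := Nat.add_one_mul_choose_eq (s + m) m
      have h2 : ((s + m + 1 : ℕ) : ℝ) * (s + m).choose m =
          (s + m + 1).choose (m + 1) * (m + 1 : ℕ) :=
        by exact_mod_cast h1
      rw [← add_assoc]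
      push_cast at h2 ⊢
      field_simp
      linarith
  rw [h]
  have h1 : (s + m).choose m ≤ 2 ^ (s + m) := Nat.choose_le_two_pow _ _
  have h2 : 2 ^ (s + m) ≤ 4 ^ s := by
    rw [show 4 = 2 ^ 2 by norm_num, ← pow_mul]
    exact Nat.pow_le_pow_right (by norm_num) (by omega)
  exact_mod_cast h1.trans h2

/-- The exponent is `4s + 2s + s`. The first `s` Euler factors contribute at most `4 ^ s ≤ e^(4s)`,
the factors `exp (2 x^j)` at most `e^(2s)` because `∑ x^j ≤ x / (1 - x) = s`, and dividing by `x ^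
n` costs at most `e^(n/s) ≤ e^s`. -/
theorem partitionCount_le_exp {n s : ℕ} (hs : 0 < s) (hn : n ≤ s ^ 2) :
    (partitionCount n : ℝ) ≤ Real.exp (7 * s) := by
  have hs' : (0 : ℝ) < s := Nat.cast_pos.2 hs
  set x : ℝ := (s : ℝ) / (s + 1) with hx
  have hx0 : 0 < x := by positivity
  have hx1 : x < 1 := by rw [hx, div_lt_one (by positivity)]; linarith
  have hfac : ∀ j, ∑ c ∈ Finset.range (n + 1), (x ^ (j + 1)) ^ c ≤
      (if j < s then 1 + (s : ℝ) / ((j + 1 : ℕ) : ℝ) else 1) * Real.exp (2 * x ^ (j + 1)) := by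
    intro j
    have hlt : x ^ (j + 1) < 1 := pow_lt_one₀ hx0.le hx1 (Nat.succ_ne_zero _)
    refine (sum_geom_le_inv (by positivity) hlt _).trans ?_
    split_ifs with h
    · have h1 := inv_one_sub_pow_le hs (j + 1) (Nat.succ_pos _)
      have h2 : 1 ≤ Real.exp (2 * x ^ (j + 1)) := Real.one_le_exp (by positivity)
      have h3 : 0 ≤ 1 + (s : ℝ) / ((j + 1 : ℕ) : ℝ) := by positivity
      nlinarith
    -- For `j + 1 > s` the factor is at most `2`, hence at most `1 + 2 x^(j+1) ≤ exp (2 x^(j+1))`.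
    · have hb := inv_one_sub_pow_le hs (j + 1) (Nat.succ_pos _)
      have h2 : (s : ℝ) / ((j + 1 : ℕ) : ℝ) ≤ 1 := by
        rw [div_le_one (by positivity)]
        exact_mod_cast (by omega : s ≤ j + 1)
      have h3 : (1 - x ^ (j + 1))⁻¹ ≤ 2 := by linarith
      rw [one_mul]
      have h4 : (1 - x ^ (j + 1))⁻¹ = 1 + x ^ (j + 1) * (1 - x ^ (j + 1))⁻¹ := by
        have : 1 - x ^ (j + 1) ≠ 0 := by linarith
        field_simp
        ring
      have h5 : x ^ (j + 1) * (1 - x ^ (j + 1))⁻¹ ≤ x ^ (j + 1) * 2 := by gcongr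
      have h6 := Real.add_one_le_exp (2 * x ^ (j + 1))
      linarith
  have hprod : ∏ j ∈ Finset.range n, ∑ c ∈ Finset.range (n + 1), (x ^ (j + 1)) ^ c ≤
      4 ^ s * Real.exp (2 * s) := by
    refine (Finset.prod_le_prod (fun j _ => by positivity) fun j _ => hfac j).trans ?_
    rw [Finset.prod_mul_distrib, ← Real.exp_sum]
    gcongr
    · rw [← Finset.prod_filter]
      have : (Finset.range n).filter (· < s) = Finset.range (min n s) := by
        ext j; simp
      rw [this]
      exact prod_one_add_div_le s _ (min_le_right _ _)
    · rw [← Finset.mul_sum]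
      gcongr
      simp_rw [pow_succ]
      rw [← Finset.sum_mul]
      have h1 := sum_geom_le_inv hx0.le hx1 n
      have h2 : (1 - x)⁻¹ * x = s := by
        rw [hx]; field_simp; ring
      calc _ ≤ (1 - x)⁻¹ * x := by gcongr
        _ = s := h2
  have hpow : Real.exp (-s) ≤ x ^ n := by
    have h1 : x⁻¹ ≤ Real.exp (1 / s) := by
      have := Real.add_one_le_exp (1 / (s : ℝ))
      have h2 : x⁻¹ = 1 / s + 1 := by rw [hx]; field_simp; ring
      rwa [h2]
    have h2 : (x ^ n)⁻¹ ≤ Real.exp s := by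
      rw [← inv_pow]
      calc x⁻¹ ^ n ≤ Real.exp (1 / s) ^ n := by gcongr
        _ = Real.exp (n * (1 / s)) := (Real.exp_nat_mul _ _).symm
        _ ≤ Real.exp s := by
          gcongr
          rw [mul_one_div, div_le_iff₀ hs', ← pow_two]
          exact_mod_cast hn
    rw [Real.exp_neg]
    exact inv_le_of_inv_le₀ (by positivity) h2
  have h4 : (4 : ℝ) ^ s ≤ Real.exp (4 * s) := by
    rw [mul_comm, Real.exp_nat_mul]
    have := Real.add_one_le_exp (4 : ℝ)
    gcongr
    linarith
  have hmain := (partitionCount_mul_pow_le hx0.le n).trans hprod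
  have h5 : (partitionCount n : ℝ) * Real.exp (-s) ≤ Real.exp (6 * s) := by
    calc (partitionCount n : ℝ) * Real.exp (-s) ≤ partitionCount n * x ^ n := by gcongr
      _ ≤ 4 ^ s * Real.exp (2 * s) := hmain
      _ ≤ Real.exp (4 * s) * Real.exp (2 * s) := by gcongr
      _ = Real.exp (6 * s) := by rw [← Real.exp_add]; ring_nf
  calc (partitionCount n : ℝ) = partitionCount n * Real.exp (-s) * Real.exp s := by
        rw [mul_assoc, ← Real.exp_add]; simp
    _ ≤ Real.exp (6 * s) * Real.exp s := by gcongr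
    _ = Real.exp (7 * s) := by rw [← Real.exp_add]; ring_nf

/-- Subsets of `{2, …, m + 1}`, completed by ones, give many partitions. -/
theorem two_pow_le_partitionCount {m n : ℕ} (h : (m + 1) * m ≤ n) : 2 ^ m ≤ partitionCount n := by
  classical
  let T : Finset ℕ → ℕ := fun t => ∑ j ∈ t, (j + 2)
  have hT : ∀ t ∈ (Finset.range m).powerset, T t ≤ n := by
    intro t ht
    rw [Finset.mem_powerset] at ht
    calc T t ≤ ∑ j ∈ Finset.range m, (j + 2) := Finset.sum_le_sum_of_subset ht
      _ ≤ ∑ j ∈ Finset.range m, (m + 1) :=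
        Finset.sum_le_sum fun j hj => by rw [Finset.mem_range] at hj; omega
      _ = (m + 1) * m := by simp [mul_comm]
      _ ≤ n := h
  let P : (Finset.range m).powerset → n.Partition := fun t =>
    { parts := t.1.val.map (· + 2) + Multiset.replicate (n - T t) 1
      parts_pos := by
        intro i hi
        rcases Multiset.mem_add.1 hi with hi | hi
        · obtain ⟨j, -, rfl⟩ := Multiset.mem_map.1 hi; omega
        · rw [Multiset.eq_of_mem_replicate hi]; exact one_pos
      parts_sum := by
        rw [Multiset.sum_add, Multiset.sum_replicate, smul_eq_mul, mul_one]
        exact Nat.add_sub_cancel' (hT t.1 t.2) }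
  have hP : Function.Injective P := by
    intro t u htu
    apply Subtype.ext
    ext j
    -- The shift by two keeps the chosen parts apart from the added ones, so the subset can be
    -- recovered.
    have h0 : ∀ v, j ∈ v.1 ↔ j + 2 ∈ (P v).parts := by
      intro v
      change _ ↔ j + 2 ∈ v.1.val.map (· + 2) + Multiset.replicate (n - T v) 1
      rw [Multiset.mem_add, Multiset.mem_replicate]
      simp
    rw [h0, h0, htu]
  have := Fintype.card_le_of_injective P hP
  rw [Fintype.card_coe, Finset.card_powerset, Finset.card_range] at this
  exact this

/-- Take `s = ⌊√n⌋ + 1 ≤ 2√n`. -/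
theorem partitionCount_le_exp_sqrt {n : ℕ} (hn : 0 < n) :
    (partitionCount n : ℝ) ≤ Real.exp (14 * Real.sqrt n) := by
  have h1 : 1 ≤ Real.sqrt n := Real.one_le_sqrt.2 (by exact_mod_cast hn)
  have h2 : (Nat.sqrt n : ℝ) ≤ Real.sqrt n := Real.nat_sqrt_le_real_sqrt
  refine (partitionCount_le_exp (Nat.succ_pos (Nat.sqrt n)) (Nat.lt_succ_sqrt' n).le).trans ?_
  rw [Real.exp_le_exp]
  push_cast
  linarith

/-- Lets a factor in the exponent be absorbed by the rescaling in `GrowthLE`. -/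
theorem exp_mul_sqrt (C n : ℕ) :
    Real.exp (C * Real.sqrt n) = Real.exp (Real.sqrt ((C ^ 2 * n : ℕ) : ℝ)) := by
  rw [Nat.cast_mul, Nat.cast_pow, Real.sqrt_mul (by positivity), Real.sqrt_sq (Nat.cast_nonneg C)]

theorem partitionCount_growthLE_exp : GrowthLE (fun n => (partitionCount n : ℝ))
    (fun n => Real.exp (Real.sqrt (n : ℝ))) := by
  refine ⟨1, 14 ^ 2, one_pos, by norm_num, fun n hn => ?_⟩
  have h := partitionCount_le_exp_sqrt hn
  beta_reduce
  rwa [← exp_mul_sqrt]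

/-- With `r = ⌊√n⌋` and `m = 2 (r + 1)` one has `(m + 1) m = 4r² + 10r + 6 ≤ 20 r²`, within `24 n`;
and `2 ^ m = 4 ^ (r + 1)` exceeds `e ^ √n` since `e < 4`. -/
theorem exp_growthLE_partitionCount : GrowthLE (fun n => Real.exp (Real.sqrt (n : ℝ)))
    (fun n => (partitionCount n : ℝ)) := by
  refine ⟨1, 24, one_pos, by norm_num, fun n hn => ?_⟩
  set r := Nat.sqrt n with hr
  have h1 : 1 ≤ r := Nat.sqrt_pos.2 hn
  have h2 : r ^ 2 ≤ n := Nat.sqrt_le' n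
  have h3 : 2 ^ (2 * (r + 1)) ≤ partitionCount (24 * n) :=
    two_pow_le_partitionCount (by nlinarith)
  have h4 : Real.sqrt n ≤ ((r + 1 : ℕ) : ℝ) := by
    push_cast
    exact Real.real_sqrt_le_nat_sqrt_succ
  have h5 : Real.exp 1 ≤ 4 := by linarith [Real.exp_one_lt_d9]
  calc Real.exp (Real.sqrt n) ≤ Real.exp ((r + 1 : ℕ) * 1) := by rw [mul_one]; gcongr
    _ = Real.exp 1 ^ (r + 1) := Real.exp_nat_mul _ _
    _ ≤ 4 ^ (r + 1) := by gcongr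
    _ = ((2 ^ (2 * (r + 1)) : ℕ) : ℝ) := by rw [pow_mul]; norm_num
    _ ≤ partitionCount (24 * n) := Nat.cast_le.2 h3

theorem partitionCount_growthEquiv_exp : GrowthEquiv (fun n => (partitionCount n : ℝ))
    (fun n => Real.exp (Real.sqrt (n : ℝ))) :=
  ⟨partitionCount_growthLE_exp, exp_growthLE_partitionCount⟩

end Partitions

end KobayashiAlgebra

namespace KobayashiAlgebra

/-! ### Counting normal words by partitions. -/

section GrowthOfA

local notation "W" => FreeMonoid Letter
local notation "W₀" => WithZero (FreeMonoid Letter)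

open NormalForm

instance : DecidableEq Letter := fun x y => by
  cases x <;> cases y <;> first | exact isTrue rfl | exact isFalse (by simp)

instance : Fintype Letter := ⟨{.a, .b, .c}, fun x => by cases x <;> simp⟩

theorem finite_length_le (n : ℕ) : {w : W | w.length ≤ n}.Finite :=
  List.finite_length_le Letter n

theorem finite_normalWords_length (n : ℕ) : {w : W | w ∈ normalWords ∧ w.length = n}.Finite :=
  (finite_length_le n).subset fun _ h => h.2.le

@[simp] theorem length_wa_pow (n : ℕ) : (wa ^ n).length = n := by
  induction n with
  | zero => rfl
  | succ n ih => rw [pow_succ, FreeMonoid.length_mul, ih]; rfl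

@[simp] theorem length_wb_pow (n : ℕ) : (wb ^ n).length = n := by
  induction n with
  | zero => rfl
  | succ n ih => rw [pow_succ, FreeMonoid.length_mul, ih]; rfl

@[simp] theorem length_blocks (m : List ℕ) : (blocks m).length = (m.map (· + 1)).sum := by
  induction m with
  | nil => rfl
  | cons i m ih =>
    rw [blocks_cons, FreeMonoid.length_mul, FreeMonoid.length_mul, ih, length_wa_pow]; rfl

theorem blocks_injOn : Set.InjOn blocks {m | m.Pairwise (· ≤ ·)} := by
  have key : ∀ m : List ℕ, m.Pairwise (· ≤ ·) → ∃ d : NormalForm, d.Sorted ∧ blocks m = d.toWord ∧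
      m = match d with | cword _ i m _ _ => i :: m | _ => [] := by
    rintro (_ | ⟨i, m⟩) hm
    · exact ⟨pow 0, trivial, rfl, rfl⟩
    · exact ⟨cword false i m 0 0, hm, by simp [toWord], rfl⟩
  intro m hm m' hm' h
  obtain ⟨d, hd, hb, rfl⟩ := key m hm
  obtain ⟨d', hd', hb', rfl⟩ := key m' hm'
  have h1 := normalForm_toWord hd
  rw [← hb, h, hb', normalForm_toWord hd'] at h1
  rw [Option.some.inj h1]

/-- The exponents of the blocks attached to a partition: the parts, in nondecreasing order,
decreased by one. -/
def blockExponents {n : ℕ} (p : n.Partition) : List ℕ := (p.parts.sort (· ≤ ·)).map (· - 1)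

theorem map_blockExponents {n : ℕ} (p : n.Partition) :
    (blockExponents p).map (· + 1) = p.parts.sort (· ≤ ·) := by
  rw [blockExponents, List.map_map]
  refine (List.map_congr_left fun i hi => ?_).trans (List.map_id _)
  have := p.parts_pos ((Multiset.mem_sort _).1 hi)
  simp only [Function.comp_apply, id_eq]
  omega

theorem pairwise_blockExponents {n : ℕ} (p : n.Partition) :
    (blockExponents p).Pairwise (· ≤ ·) := by
  rw [blockExponents, List.pairwise_map]
  exact (Multiset.pairwise_sort _ _).imp fun h => Nat.sub_le_sub_right h 1

theorem length_blocks_blockExponents {n : ℕ} (p : n.Partition) :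
    (blocks (blockExponents p)).length = n := by
  rw [length_blocks, map_blockExponents, ← Multiset.sum_coe, Multiset.sort_eq, p.parts_sum]

theorem blocks_mem_normalWords {m : List ℕ} (hm : m.Pairwise (· ≤ ·)) : blocks m ∈ normalWords :=
  ⟨0, 0, 0, m, by simp, hm, by simp [blocks]⟩

/-- Lowering every part by one gives block exponents of a normal word of length `n` made of blocks
only. -/
theorem partitionCount_le_ncard (n : ℕ) :
    partitionCount n ≤ {w : W | w ∈ normalWords ∧ w.length = n}.ncard := by
  classical
  let f : n.Partition → W := fun p => blocks (blockExponents p)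
  have hf : Function.Injective f := by
    intro p q h
    have h1 := congrArg (List.map (· + 1))
      (blocks_injOn (pairwise_blockExponents p) (pairwise_blockExponents q) h)
    rw [map_blockExponents, map_blockExponents] at h1
    have h2 := congrArg (fun l : List ℕ => (l : Multiset ℕ)) h1
    simp only [Multiset.sort_eq] at h2
    exact Nat.Partition.ext h2
  have h1 : ((Finset.univ.image f : Finset W) : Set W) ⊆
      {w : W | w ∈ normalWords ∧ w.length = n} := by
    intro w hw
    obtain ⟨p, -, rfl⟩ := Finset.mem_image.1 (Finset.mem_coe.1 hw)
    exact ⟨blocks_mem_normalWords (pairwise_blockExponents p), length_blocks_blockExponents p⟩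
  have h2 := Set.ncard_le_ncard h1 (finite_normalWords_length n)
  rwa [Set.ncard_coe_finset, Finset.card_image_of_injective _ hf] at h2

theorem exists_blockExponents {m : List ℕ} (hm : m.Pairwise (· ≤ ·)) :
    ∃ p : ((m.map (· + 1)).sum).Partition, blockExponents p = m := by
  refine ⟨⟨(m.map (· + 1) : List ℕ), ?_, by simp⟩, ?_⟩
  · intro i hi
    obtain ⟨j, -, rfl⟩ := List.mem_map.1 (Multiset.mem_coe.1 hi)
    omega
  · rw [blockExponents]
    have : (m.map (· + 1)).Pairwise (· ≤ ·) := by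
      rw [List.pairwise_map]
      exact hm.imp fun h => Nat.succ_le_succ h
    rw [Multiset.coe_sort, List.mergeSort_eq_self _ (by simpa using this), List.map_map]
    exact List.map_id'' (fun _ => rfl) _

/-- A normal word is determined by `s`, `l`, `t` and a partition of the total length of its blocks.
-/
theorem ncard_normalWords_le (n : ℕ) :
    {w : W | w ∈ normalWords ∧ w.length ≤ n}.ncard ≤
      2 * (n + 1) ^ 2 * ∑ j ∈ Finset.range (n + 1), partitionCount j := by
  classical
  let f : Bool × Fin (n + 1) × Fin (n + 1) × (Σ j : Fin (n + 1), (j : ℕ).Partition) → W :=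
    fun x => wb ^ x.1.toNat * blocks (blockExponents x.2.2.2.2) * wa ^ (x.2.1 : ℕ) *
      wb ^ (x.2.2.1 : ℕ)
  have h1 : {w : W | w ∈ normalWords ∧ w.length ≤ n} ⊆
      ((Finset.univ.image f : Finset W) : Set W) := by
    rintro _ ⟨⟨s, l, t, m, hs, hm, rfl⟩, hn⟩
    obtain ⟨s, rfl⟩ : ∃ b : Bool, s = b.toNat := by
      interval_cases s
      · exact ⟨false, rfl⟩
      · exact ⟨true, rfl⟩
    change (wb ^ s.toNat * blocks m * wa ^ l * wb ^ t).length ≤ n at hn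
    simp only [FreeMonoid.length_mul, length_wa_pow, length_wb_pow, length_blocks] at hn
    obtain ⟨p, hp⟩ := exists_blockExponents hm
    have hj : (m.map (· + 1)).sum < n + 1 := by omega
    rw [Finset.coe_image, Finset.coe_univ, Set.image_univ]
    exact ⟨(s, ⟨l, by omega⟩, ⟨t, by omega⟩, ⟨⟨_, hj⟩, p⟩), by
      change wb ^ s.toNat * blocks (blockExponents p) * wa ^ l * wb ^ t = _
      rw [hp]; rfl⟩
  have h2 := Set.ncard_le_ncard h1 (Finset.finite_toSet _)
  rw [Set.ncard_coe_finset] at h2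
  refine h2.trans (Finset.card_image_le.trans (le_of_eq ?_))
  rw [Finset.card_univ]
  simp only [Fintype.card_prod, Fintype.card_bool, Fintype.card_fin, Fintype.card_sigma]
  rw [← Fin.sum_univ_eq_sum_range]
  simp only [partitionCount]
  ring

/-- The constant is `1 + 6 + 14`: with `u = √n`, `2 ≤ e^u`, `(n + 1)^3 ≤ e^(6u)` because `n + 1 ≤ (u
+ 1)^2`, and `p(j) ≤ e^(14u)` for `j ≤ n`. -/
theorem ncard_normalWords_le_exp {n : ℕ} (hn : 0 < n) :
    ({w : W | w ∈ normalWords ∧ w.length ≤ n}.ncard : ℝ) ≤ Real.exp (21 * Real.sqrt n) := by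
  have h1 : 1 ≤ Real.sqrt n := Real.one_le_sqrt.2 (by exact_mod_cast hn)
  have hp : ∀ j ∈ Finset.range (n + 1), (partitionCount j : ℝ) ≤ Real.exp (14 * Real.sqrt n) := by
    intro j hj
    rcases Nat.eq_zero_or_pos j with rfl | hj0
    · have : partitionCount 0 = 1 := by simp [partitionCount]
      rw [this, Nat.cast_one]
      exact Real.one_le_exp (by positivity)
    · refine (partitionCount_le_exp_sqrt hj0).trans ?_
      gcongr
      exact Nat.lt_succ_iff.1 (Finset.mem_range.1 hj)
  have h2 : (n : ℝ) + 1 ≤ Real.exp (2 * Real.sqrt n) := by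
    have h3 := Real.add_one_le_exp (Real.sqrt n)
    have h4 := Real.mul_self_sqrt (Nat.cast_nonneg (α := ℝ) n)
    rw [two_mul, Real.exp_add]
    nlinarith
  have h3 : (2 : ℝ) ≤ Real.exp (Real.sqrt n) := by
    have := Real.add_one_le_exp (Real.sqrt n)
    linarith
  have h4 := ncard_normalWords_le n
  calc ({w : W | w ∈ normalWords ∧ w.length ≤ n}.ncard : ℝ)
      ≤ ((2 * (n + 1) ^ 2 * ∑ j ∈ Finset.range (n + 1), partitionCount j : ℕ) : ℝ) :=
        Nat.cast_le.2 h4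
    _ = 2 * (n + 1 : ℝ) ^ 2 * ∑ j ∈ Finset.range (n + 1), (partitionCount j : ℝ) := by
        push_cast; rfl
    _ ≤ 2 * (n + 1 : ℝ) ^ 2 * ∑ j ∈ Finset.range (n + 1), Real.exp (14 * Real.sqrt n) := by
        gcongr with j hj; exact hp j hj
    _ = 2 * (n + 1 : ℝ) ^ 3 * Real.exp (14 * Real.sqrt n) := by simp; ring
    _ ≤ Real.exp (Real.sqrt n) * Real.exp (2 * Real.sqrt n) ^ 3 * Real.exp (14 * Real.sqrt n) := by
        gcongr
    _ = Real.exp (21 * Real.sqrt n) := by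
        rw [← Real.exp_nat_mul, ← Real.exp_add, ← Real.exp_add]; congr 1; push_cast; ring

variable (k : Type*) [Field k]

open Classical in
/-- The generators `a, b, c` of `A`. -/
noncomputable def generators : Finset (A k) := Finset.univ.image (gen k)

theorem coe_generators : (generators k : Set (A k)) = Set.range (gen k) := by
  classical
  simp [generators]

theorem adjoin_generators : Algebra.adjoin k (generators k : Set (A k)) = ⊤ := by
  have h := congrArg (Subalgebra.map (proj k)) (FreeAlgebra.adjoin_range_ι k Letter)
  rw [AlgHom.map_adjoin, ← Set.range_comp, Algebra.map_top,
    (AlgHom.range_eq_top _).2 (RingQuot.mkAlgHom_surjective k (Rel k))] at h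
  rw [coe_generators]
  exact h

theorem growthFunction_generators (n : ℕ) :
    growthFunction k (generators k) n = {w : W | w ∈ normalWords ∧ w.length ≤ n}.ncard := by
  have h1 : {x : A k | ∃ l : List (A k), (∀ y ∈ l, y ∈ generators k) ∧ l.length ≤ n ∧ l.prod = x} =
      wordImage k '' {w | w.length ≤ n} := by
    ext x
    constructor
    · rintro ⟨l, hl, hn, rfl⟩
      have : ∃ w : W, w.length = l.length ∧ wordImage k w = l.prod := by
        clear hn
        induction l with
        | nil => exact ⟨1, rfl, wordImage_one k⟩
        | cons y l ih =>
          obtain ⟨w, hw, hp⟩ := ih fun z hz => hl z (List.mem_cons_of_mem _ hz)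
          have hy : y ∈ Set.range (gen k) := by
            rw [← coe_generators]; exact hl y (by simp)
          obtain ⟨x, rfl⟩ := hy
          exact ⟨FreeMonoid.of x * w, by rw [FreeMonoid.length_mul, hw, add_comm]; rfl, by
            rw [wordImage_mul, wordImage_of, hp, List.prod_cons]⟩
      obtain ⟨w, hw, hp⟩ := this
      exact ⟨w, hw.trans_le hn, hp⟩
    · rintro ⟨w, hw, rfl⟩
      refine ⟨w.toList.map (gen k), ?_, by rw [List.length_map]; exact hw, ?_⟩
      · intro y hy
        obtain ⟨x, -, rfl⟩ := List.mem_map.1 hy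
        rw [← Finset.mem_coe, coe_generators]
        exact ⟨x, rfl⟩
      · rw [wordImage_eq_lift, FreeMonoid.lift_apply]
  have h2 : Submodule.span k (wordImage k '' {w : W | w.length ≤ n}) =
      Submodule.span k (wordImage k '' {w : W | w ∈ normalWords ∧ w.length ≤ n}) := by
    apply le_antisymm
    · rw [Submodule.span_le]
      rintro _ ⟨w, hw, rfl⟩
      refine image_mem_span k fun d hd =>
        ⟨mem_normalWords_iff.2 ⟨d, sorted_of_normalForm hd, rfl⟩, ?_⟩
      rw [length_toWord_normalForm hd]; exact hw
    · exact Submodule.span_mono (Set.image_mono fun w hw => hw.2)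
  rw [growthFunction, h1, h2, finrank_span_normalWords k (fun _ h => h.1)
    ((finite_length_le n).subset fun _ h => h.2)]

theorem finrank_component (n : ℕ) : Module.finrank k (component k (gen k) n) =
    {w : W | w ∈ normalWords ∧ w.length = n}.ncard := by
  rw [component_gen, finrank_span_normalWords k (fun _ h => h.1) (finite_normalWords_length n)]

theorem growthFunction_generators_le {n : ℕ} (hn : 0 < n) :
    (growthFunction k (generators k) n : ℝ) ≤ Real.exp (21 * Real.sqrt n) := by
  rw [growthFunction_generators]
  exact ncard_normalWords_le_exp hn

theorem hasGrowthType_exp : HasGrowthType k (A k) fun n => Real.exp (Real.sqrt (n : ℝ)) := by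
  refine hasGrowthType_of_growthEquiv k (adjoin_generators k) ⟨?_, ?_⟩
  · refine ⟨1, 21 ^ 2, one_pos, by norm_num, fun n hn => ?_⟩
    have h := growthFunction_generators_le k hn
    beta_reduce
    rwa [← exp_mul_sqrt]
  · refine exp_growthLE_partitionCount.trans ⟨1, 1, one_pos, one_pos, fun n _ => ?_⟩
    beta_reduce
    rw [one_mul, growthFunction_generators, Nat.cast_le]
    exact (partitionCount_le_ncard n).trans
      (Set.ncard_le_ncard (fun _ h => ⟨h.1, h.2.le⟩) ((finite_length_le n).subset fun _ h => h.2))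

end GrowthOfA

end KobayashiAlgebra

namespace KobayashiAlgebra

/-! ### Enumeration of the normal words of small length -/

section Enumeration

local notation "W" => FreeMonoid Letter

/-- Decides whether a list of letters is a normal word. -/
def isNormalWord (w : List Letter) : Bool :=
  match run (FreeMonoid.ofList w) (some (.pow 0)) with
  | none => false
  | some d => decide (d.toWord.toList = w)

theorem isNormalWord_iff (w : W) : isNormalWord w.toList = true ↔ w ∈ normalWords := by
  rw [mem_normalWords_iff_decode, normalForm_coe, isNormalWord, FreeMonoid.ofList_toList]
  rcases run w (some (.pow 0)) with _ | d
  · simp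
  · rw [decode_some, WithZero.coe_inj]
    simp

/-- All lists of letters of a given length. -/
def wordsOfLength : ℕ → List (List Letter)
  | 0 => [[]]
  | n + 1 => (wordsOfLength n).flatMap fun w => [.a :: w, .b :: w, .c :: w]

theorem mem_wordsOfLength {n : ℕ} {w : List Letter} : w ∈ wordsOfLength n ↔ w.length = n := by
  induction n generalizing w with
  | zero => simp [wordsOfLength]
  | succ n ih =>
    simp only [wordsOfLength, List.mem_flatMap, ih]
    constructor
    · rintro ⟨v, hv, h⟩
      simp only [List.mem_cons, List.not_mem_nil, or_false] at h
      rcases h with rfl | rfl | rfl <;> simp [hv]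
    · intro h
      rcases w with _ | ⟨x, w⟩
      · simp at h
      · exact ⟨w, by simpa using h, by cases x <;> simp⟩

theorem nodup_wordsOfLength (n : ℕ) : (wordsOfLength n).Nodup := by
  induction n with
  | zero => simp [wordsOfLength]
  | succ n ih =>
    rw [wordsOfLength, List.nodup_flatMap]
    refine ⟨fun w _ => by simp, ih.imp fun {u v} huv => ?_⟩
    intro x hx hy
    simp only [List.mem_cons, List.not_mem_nil, or_false] at hx hy
    rcases hx with rfl | rfl | rfl <;> simp [huv] at hy

/-- Makes the dimensions of `A_3` and `A_6` computable, by testing all `3 ^ n` words. -/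
theorem ncard_normalWords_length (n : ℕ) : {w : W | w ∈ normalWords ∧ w.length = n}.ncard =
    ((wordsOfLength n).filter isNormalWord).length := by
  have h : FreeMonoid.toList '' {w : W | w ∈ normalWords ∧ w.length = n} =
      (((wordsOfLength n).filter isNormalWord).toFinset : Set (List Letter)) := by
    ext l
    simp only [List.coe_toFinset, List.mem_filter, mem_wordsOfLength]
    constructor
    · rintro ⟨w, ⟨hw, hn⟩, rfl⟩
      exact ⟨hn, (isNormalWord_iff w).2 hw⟩
    · rintro ⟨hn, hl⟩
      exact ⟨FreeMonoid.ofList l, ⟨(isNormalWord_iff _).1 hl, hn⟩, rfl⟩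
  rw [← Set.ncard_image_of_injective _ FreeMonoid.toList.injective, h, Set.ncard_coe_finset,
    List.toFinset_card_of_nodup ((nodup_wordsOfLength n).filter _)]

theorem ncard_normalWords_three : {w : W | w ∈ normalWords ∧ w.length = 3}.ncard = 20 := by
  rw [ncard_normalWords_length]
  decide +kernel

theorem ncard_normalWords_six : {w : W | w ∈ normalWords ∧ w.length = 6}.ncard = 119 := by
  rw [ncard_normalWords_length]
  decide +kernel

end Enumeration

/-! ### Cutting words into blocks of three: the kernel is generated in degree two. -/

section Veronese

local notation "W" => FreeMonoid Letter
local notation "W₀" => WithZero (FreeMonoid Letter)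

open NormalForm

/-- The normal words of length three. -/
abbrev NormalTriple : Type := {w : W // w ∈ normalWords ∧ w.length = 3}

theorem card_normalTriple : Nat.card NormalTriple = 20 := ncard_normalWords_three

/-- An enumeration of the normal words of length three. -/
noncomputable def tripleEquiv : Fin 20 ≃ NormalTriple :=
  have : Finite NormalTriple := finite_normalWords_length 3
  (Finite.equivFinOfCardEq card_normalTriple).symm

/-- The normal word of length three with a given index. -/
noncomputable def triple (i : Fin 20) : W := (tripleEquiv i).1

theorem triple_mem (i : Fin 20) : triple i ∈ normalWords := (tripleEquiv i).2.1
@[simp] theorem length_triple (i : Fin 20) : (triple i).length = 3 := (tripleEquiv i).2.2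

/-- Concatenation of normal words of length three. -/
noncomputable def concat : FreeMonoid (Fin 20) →* W := FreeMonoid.lift triple

theorem length_concat (u : FreeMonoid (Fin 20)) : (concat u).length = 3 * u.length := by
  induction u using FreeMonoid.inductionOn' with
  | one => simp
  | of_mul i u ih =>
    rw [map_mul, FreeMonoid.length_mul, ih, concat, FreeMonoid.lift_eval_of, length_triple,
      FreeMonoid.length_mul, FreeMonoid.length_of]
    ring

variable (k : Type*) [Field k]

local notation "F" => FreeAlgebra k (Fin 20)

/-- The homomorphism from the free algebra to `A` sending the generators to the normal words of
length three. -/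
noncomputable def tripleHom : F →ₐ[k] A k := FreeAlgebra.lift k fun i => wordImage k (triple i)

theorem tripleHom_lift (u : FreeMonoid (Fin 20)) :
    tripleHom k (FreeMonoid.lift (FreeAlgebra.ι k) u) = wordImage k (concat u) := by
  induction u using FreeMonoid.inductionOn' with
  | one => simp
  | of_mul i u ih =>
    rw [map_mul, map_mul, ih, map_mul, wordImage_mul, FreeMonoid.lift_eval_of, concat,
      FreeMonoid.lift_eval_of, tripleHom, FreeAlgebra.lift_ι_apply]

open Classical in
/-- The element of degree one of the free algebra representing a word of length three. -/
noncomputable def blockElem (B : W) : F :=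
  match normalForm (B : W₀) with
  | none => 0
  -- For a word of length three the condition always holds; the default `0` is never used.
  | some d => if h : d.toWord ∈ normalWords ∧ d.toWord.length = 3 then
      FreeAlgebra.ι k (tripleEquiv.symm ⟨d.toWord, h⟩) else 0

theorem blockElem_congr {B B' : W} (h : normalForm (B : W₀) = normalForm (B' : W₀)) :
    blockElem k B = blockElem k B' := by
  rw [blockElem, blockElem, h]

theorem blockElem_eq_zero {B : W} (h : normalForm (B : W₀) = none) : blockElem k B = 0 := by
  rw [blockElem, h]

theorem blockElem_eq_ι {B : W} (hB : B.length = 3) {d : NormalForm}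
    (h : normalForm (B : W₀) = some d) :
    ∃ i, triple i = d.toWord ∧ blockElem k B = FreeAlgebra.ι k i := by
  have h0 : d.toWord ∈ normalWords ∧ d.toWord.length = 3 :=
    ⟨mem_normalWords_iff.2 ⟨d, sorted_of_normalForm h, rfl⟩,
      (length_toWord_normalForm h).trans hB⟩
  refine ⟨tripleEquiv.symm ⟨d.toWord, h0⟩, by rw [triple, Equiv.apply_symm_apply], ?_⟩
  rw [blockElem, h]
  exact dif_pos h0

theorem blockElem_triple (i : Fin 20) : blockElem k (triple i) = FreeAlgebra.ι k i := by
  obtain ⟨d, hd, h⟩ := mem_normalWords_iff.1 (triple_mem i)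
  have hn := normalForm_toWord hd
  rw [h] at hn
  obtain ⟨j, hj, hj'⟩ := blockElem_eq_ι k (length_triple i) hn
  rw [hj']
  congr 1
  exact tripleEquiv.injective (Subtype.ext (hj.trans h))

theorem ι_mem_component (i : Fin 20) :
    FreeAlgebra.ι k i ∈ component k (FreeAlgebra.ι k : Fin 20 → F) 1 :=
  Submodule.subset_span ⟨[i], rfl, by simp⟩

theorem blockElem_mem_component {B : W} (hB : B.length = 3) :
    blockElem k B ∈ component k (FreeAlgebra.ι k : Fin 20 → F) 1 := by
  rcases h : normalForm (B : W₀) with _ | d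
  · rw [blockElem_eq_zero k h]; exact Submodule.zero_mem _
  · obtain ⟨i, -, hi⟩ := blockElem_eq_ι k hB h
    rw [hi]; exact ι_mem_component k i

theorem tripleHom_blockElem {B : W} (hB : B.length = 3) :
    tripleHom k (blockElem k B) = wordImage k B := by
  rw [← image_coe, ← image_normalForm]
  rcases h : normalForm (B : W₀) with _ | d
  · rw [blockElem_eq_zero k h]; simp
  · obtain ⟨i, hi, hi'⟩ := blockElem_eq_ι k hB h
    rw [hi', decode_some, image_coe, ← hi, tripleHom, FreeAlgebra.lift_ι_apply]

/-- The element of the free algebra obtained by cutting a word into blocks of length three; zero if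
the length is not divisible by three. -/
noncomputable def chop : List Letter → F
  | [] => 1
  | [_] => 0
  | [_, _] => 0
  | x :: y :: z :: w => blockElem k (FreeMonoid.ofList [x, y, z]) * chop w

theorem chop_append {u : List Letter} (hu : u.length = 3) (w : List Letter) :
    chop k (u ++ w) = blockElem k (FreeMonoid.ofList u) * chop k w := by
  obtain ⟨x, y, z, rfl⟩ := List.length_eq_three.1 hu
  rfl

theorem chop_concat (u : FreeMonoid (Fin 20)) :
    chop k (concat u).toList = FreeMonoid.lift (FreeAlgebra.ι k) u := by
  induction u using FreeMonoid.inductionOn' with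
  | one => rfl
  | of_mul i u ih =>
    rw [map_mul concat, map_mul (FreeMonoid.lift _), FreeMonoid.toList_mul, concat,
      FreeMonoid.lift_eval_of, FreeMonoid.lift_eval_of, chop_append k (length_triple i), ← concat, ih]
    rw [← blockElem_triple]
    rfl

theorem chop_spec (n : ℕ) {w : List Letter} (hw : w.length = 3 * n) :
    chop k w ∈ component k (FreeAlgebra.ι k : Fin 20 → F) n ∧
      tripleHom k (chop k w) = wordImage k (FreeMonoid.ofList w) := by
  induction n generalizing w with
  | zero =>
    obtain rfl : w = [] := List.length_eq_zero_iff.1 (by omega)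
    exact ⟨one_mem_component k _, by simp [chop]⟩
  | succ n ih =>
    rcases w with _ | ⟨x, _ | ⟨y, _ | ⟨z, w⟩⟩⟩ <;>
      simp only [List.length_cons, List.length_nil] at hw
    · omega
    · omega
    · omega
    · have hB : (FreeMonoid.ofList [x, y, z]).length = 3 := rfl
      obtain ⟨h1, h2⟩ := ih (w := w) (by omega)
      refine ⟨?_, ?_⟩
      · rw [add_comm]
        exact component_mul k _ 1 n (Submodule.mul_mem_mul (blockElem_mem_component k hB) h1)
      · rw [chop, map_mul, h2, tripleHom_blockElem k hB, ← wordImage_mul]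
        rfl

/-- The relations of degree two. -/
noncomputable def quadraticRelations : Submodule k F :=
  component k (FreeAlgebra.ι k : Fin 20 → F) 2 ⊓ LinearMap.ker (tripleHom k).toLinearMap

/-- The ideal generated by the relations of degree two. -/
noncomputable def quadraticIdeal : TwoSidedIdeal F :=
  TwoSidedIdeal.span (quadraticRelations k : Set F)

/-- The projection modulo the quadratic relations. -/
noncomputable def quadraticMk : F →ₐ[k] (quadraticIdeal k).ringCon.Quotient :=
  (quadraticIdeal k).ringCon.mkₐ k

theorem quadraticMk_eq_zero {x : F} : quadraticMk k x = 0 ↔ x ∈ quadraticIdeal k := by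
  constructor
  · exact fun h => mem_of_ringCon_mk_eq_zero _ h
  · exact fun h => (RingCon.eq _).2 ((TwoSidedIdeal.mem_iff _ _).1 h)

/-- `chop` for words and zero. -/
noncomputable def chopZero : W₀ → F
  | none => 0
  | some w => chop k w.toList

@[simp] theorem chopZero_zero : chopZero k 0 = 0 := rfl
@[simp] theorem chopZero_coe (w : W) : chopZero k (w : W₀) = chop k w.toList := rfl

/-- Words of length six are cut into quadratic elements, so an equality of their images in `A` is
itself one of the quadratic relations. -/
theorem quadraticMk_chopZero_eq {w w' : W₀} (hw : w = 0 ∨ ∃ u : W, u.length = 6 ∧ w = u)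
    (hw' : w' = 0 ∨ ∃ u : W, u.length = 6 ∧ w' = u) (h : image k w = image k w') :
    quadraticMk k (chopZero k w) = quadraticMk k (chopZero k w') := by
  have key : ∀ z : W₀, (z = 0 ∨ ∃ u : W, u.length = 6 ∧ z = u) →
      chopZero k z ∈ component k (FreeAlgebra.ι k : Fin 20 → F) 2 ∧
        tripleHom k (chopZero k z) = image k z := by
    rintro z (rfl | ⟨u, hu, rfl⟩)
    · simp
    · exact chop_spec k 2 hu
  obtain ⟨h1, h2⟩ := key w hw
  obtain ⟨h1', h2'⟩ := key w' hw'
  rw [← sub_eq_zero, ← map_sub, quadraticMk_eq_zero]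
  refine TwoSidedIdeal.subset_span ⟨Submodule.sub_mem _ h1 h1', ?_⟩
  change tripleHom k _ = 0
  rw [map_sub, h2, h2', h, sub_self]

/-- Changing a block of three letters in a word changes one or two of the blocks of `chop`. -/
theorem exists_chop_eq (x y : List Letter) :
    (∀ u : List Letter, u.length = 3 → chop k (x ++ u ++ y) = 0) ∨
      ∃ (L R : F) (p q : List Letter), (p.length + q.length = 0 ∨ p.length + q.length = 3) ∧
        ∀ u : List Letter, u.length = 3 → chop k (x ++ u ++ y) = L * chop k (p ++ u ++ q) * R := by
  have h3 : ∀ {P : List Letter → Prop}, (∀ x y z, P [x, y, z]) → ∀ u, u.length = 3 → P u := by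
    intro P hP u hu
    obtain ⟨x, y, z, rfl⟩ := List.length_eq_three.1 hu
    exact hP x y z
  match x, y with
  | [], y =>
    exact .inr ⟨1, chop k y, [], [], .inl rfl, h3 fun _ _ _ => by simp [chop]⟩
  -- When too little of `y` is left to fill the second block, the whole word has four or five
  -- letters and `chop` is zero by default.
  | [_], [] => exact .inl (h3 fun _ _ _ => by simp [chop])
  | [_], [_] => exact .inl (h3 fun _ _ _ => by simp [chop])
  | [p], q :: q' :: y =>
    exact .inr ⟨1, chop k y, [p], [q, q'], .inr rfl, h3 fun _ _ _ => by simp [chop, mul_assoc]⟩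
  | [_, _], [] => exact .inl (h3 fun _ _ _ => by simp [chop])
  | [p, p'], q :: y =>
    exact .inr ⟨1, chop k y, [p, p'], [q], .inr rfl, h3 fun _ _ _ => by simp [chop, mul_assoc]⟩
  | p :: p' :: p'' :: x, y =>
    rcases exists_chop_eq x y with h | ⟨L, R, s, t, hst, h⟩
    · exact .inl fun u hu => by simp only [List.cons_append, chop, h u hu, mul_zero]
    · exact .inr ⟨blockElem k (FreeMonoid.ofList [p, p', p'']) * L, R, s, t, hst, fun u hu => by
        simp only [List.cons_append, chop, h u hu, mul_assoc]⟩

theorem length_of_mem_ruleSet {u : W} {v : W₀} (h : (u, v) ∈ ruleSet) :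
    u.length = 3 ∧ (v = 0 ∨ ∃ v' : W, v'.length = 3 ∧ v = v') := by
  simp only [ruleSet, Set.mem_insert_iff, Set.mem_singleton_iff, Prod.mk.injEq] at h
  rcases h with ⟨rfl, rfl⟩ | ⟨rfl, rfl⟩ | ⟨rfl, rfl⟩ | ⟨rfl, rfl⟩ | ⟨rfl, rfl⟩ | ⟨rfl, rfl⟩ |
    ⟨rfl, rfl⟩
  · exact ⟨rfl, .inr ⟨_, rfl, rfl⟩⟩
  · exact ⟨rfl, .inr ⟨_, rfl, rfl⟩⟩
  all_goals exact ⟨rfl, .inl rfl⟩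

/-- If the rule fills exactly one block, both sides have the same normal form and already agree in
the free algebra. If it straddles two blocks, the window has six letters and a quadratic relation
applies. -/
theorem quadraticMk_chop_rule {u : W} {v : W₀} (h : (u, v) ∈ ruleSet) {p q : W}
    (hpq : p.length + q.length = 0 ∨ p.length + q.length = 3) :
    quadraticMk k (chopZero k (p * u * q)) = quadraticMk k (chopZero k (p * v * q)) := by
  have he : Relation.EqvGen ruleSet.Step ((p : W₀) * u * q) (p * v * q) :=
    eqvGen_mul_mul (.rel _ _ (.of_mem h)) p q
  obtain ⟨hu, hv⟩ := length_of_mem_ruleSet h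
  rcases hpq with hpq | hpq
  · obtain rfl : p = 1 := FreeMonoid.length_eq_zero.1 (by omega)
    obtain rfl : q = 1 := FreeMonoid.length_eq_zero.1 (by omega)
    simp only [WithZero.coe_one, one_mul, mul_one] at he ⊢
    have hn := normalForm_eq_of_eqvGen he
    congr 1
    have hc : ∀ w : W, w.length = 3 → chop k w.toList = blockElem k w := fun w hw => by
      have := chop_append k (u := w.toList) hw []
      simpa [chop] using this
    rcases hv with rfl | ⟨v', hv', rfl⟩
    · rw [chopZero_coe, hc u hu, blockElem_eq_zero k hn, chopZero_zero]
    · rw [chopZero_coe, chopZero_coe, hc u hu, hc v' hv', blockElem_congr k hn]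
  · refine quadraticMk_chopZero_eq k ?_ ?_ (image_eq_of_eqvGen k he)
    · exact .inr ⟨p * u * q, by simp only [FreeMonoid.length_mul]; omega, rfl⟩
    · rcases hv with rfl | ⟨v', hv', rfl⟩
      · exact .inl (by simp)
      · exact .inr ⟨p * v' * q, by simp only [FreeMonoid.length_mul]; omega, rfl⟩

theorem quadraticMk_chopZero_of_eqvGen {w w' : W₀} (h : Relation.EqvGen ruleSet.Step w w') :
    quadraticMk k (chopZero k w) = quadraticMk k (chopZero k w') := by
  induction h with
  | rel _ _ hs =>
    obtain ⟨x, y, u, v, hr, rfl, rfl⟩ := hs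
    obtain ⟨hu, hv⟩ := length_of_mem_ruleSet hr
    rcases exists_chop_eq k x.toList y.toList with h | ⟨L, R, p, q, hpq, h⟩
    · have h1 : chopZero k ((x * u * y : W) : W₀) = 0 := h u.toList hu
      have h2 : chopZero k ((x : W₀) * v * y) = 0 := by
        rcases hv with rfl | ⟨v', hv', rfl⟩
        · simp
        · exact h v'.toList hv'
      rw [h1, h2]
    · have h0 := quadraticMk_chop_rule k hr (p := FreeMonoid.ofList p)
        (q := FreeMonoid.ofList q) hpq
      have h1 : chopZero k ((x * u * y : W) : W₀) = L * chopZero k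
          ((FreeMonoid.ofList p : W₀) * u * (FreeMonoid.ofList q : W)) * R := h u.toList hu
      have h2 : chopZero k ((x : W₀) * v * y) = L * chopZero k
          ((FreeMonoid.ofList p : W₀) * v * (FreeMonoid.ofList q : W)) * R := by
        rcases hv with rfl | ⟨v', hv', rfl⟩
        · simp
        · exact h v'.toList hv'
      rw [h1, h2, map_mul, map_mul, h0, map_mul, map_mul]
  | refl => rfl
  | symm _ _ _ ih => exact ih.symm
  | trans _ _ _ _ _ ih₁ ih₂ => exact ih₁.trans ih₂

/-- A linear map from `A` to the quadratic algebra that is inverse to `tripleHom`. -/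
noncomputable def veroneseInverse : A k →ₗ[k] (quadraticIdeal k).ringCon.Quotient :=
  (Finsupp.linearCombination k fun d : NormalForm =>
    quadraticMk k (chopZero k (d.toWord : W₀))).comp (coords k)

theorem veroneseInverse_image (w : W₀) :
    veroneseInverse k (image k w) = quadraticMk k (chopZero k w) := by
  rw [quadraticMk_chopZero_of_eqvGen k (eqvGen_normalForm w), veroneseInverse,
    LinearMap.comp_apply, coords_image]
  rcases normalForm w with _ | d
  · simp [vec]
  · simp [vec]

theorem veroneseInverse_tripleHom (x : F) :
    veroneseInverse k (tripleHom k x) = quadraticMk k x := by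
  have h : (veroneseInverse k).comp (tripleHom k).toLinearMap = (quadraticMk k).toLinearMap := by
    refine LinearMap.ext_on_range (span_range_lift_ι k (Fin 20)) fun u => ?_
    change veroneseInverse k (tripleHom k _) = quadraticMk k _
    rw [tripleHom_lift, ← image_coe, veroneseInverse_image, chopZero_coe, chop_concat]
  exact LinearMap.congr_fun h x

/-- Modulo the quadratic ideal, `chop` depends only on the class of a word, so it descends to
`veroneseInverse`, through which the projection `quadraticMk` factors. An element killed by
`tripleHom` is therefore killed by the projection. -/
theorem ker_tripleHom : TwoSidedIdeal.ker (tripleHom k) = quadraticIdeal k := by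
  apply le_antisymm
  · intro x hx
    rw [TwoSidedIdeal.mem_ker] at hx
    rw [← quadraticMk_eq_zero, ← veroneseInverse_tripleHom, hx, map_zero]
  · rw [quadraticIdeal, TwoSidedIdeal.span_le]
    exact fun x hx => (TwoSidedIdeal.mem_ker _).2 hx.2

end Veronese

end KobayashiAlgebra

namespace KobayashiAlgebra

/-! ### The quadratic presentation of the Veronese subalgebra. -/

section VeronesePresentation

local notation "W" => FreeMonoid Letter

variable (k : Type*) [Field k]

local notation "F" => FreeAlgebra k (Fin 20)
local notation "V₃" => veronese k (gen k) 3

theorem mem_veronese {x : A k} : x ∈ V₃ ↔ x ∈ ⨆ n : ℕ, component k (gen k) (3 * n) := Iff.rfl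

theorem wordImage_triple_mem_component (i : Fin 20) :
    wordImage k (triple i) ∈ component k (gen k) (3 * 1) := by
  have := wordImage_mem_component k (triple i)
  rwa [length_triple] at this

theorem component_le_veronese (n : ℕ) {x : A k} (hx : x ∈ component k (gen k) (3 * n)) :
    x ∈ V₃ :=
  (mem_veronese k).2 (Submodule.mem_iSup_of_mem n hx)

/-- The generators of the Veronese subalgebra. -/
noncomputable def veroneseGen (i : Fin 20) : V₃ :=
  ⟨wordImage k (triple i), component_le_veronese k 1 (wordImage_triple_mem_component k i)⟩

/-- The presentation of the Veronese subalgebra. -/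
noncomputable def veroneseHom : F →ₐ[k] V₃ := FreeAlgebra.lift k (veroneseGen k)

theorem val_veroneseHom (x : F) : ((veroneseHom k x : V₃) : A k) = tripleHom k x := by
  have h : (V₃).val.comp (veroneseHom k) = tripleHom k := by
    ext i
    simp [veroneseHom, tripleHom, veroneseGen]
  exact AlgHom.congr_fun h x

/-- `chop` supplies the preimages. The case `n = 2` gives the rank used to count relations; all `n`
together give surjectivity onto the Veronese subalgebra. -/
theorem map_component_tripleHom (n : ℕ) :
    (component k (FreeAlgebra.ι k : Fin 20 → F) n).map (tripleHom k).toLinearMap =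
      component k (gen k) (3 * n) := by
  apply le_antisymm
  · rw [component_eq_span, Submodule.map_span, Submodule.span_le]
    rintro _ ⟨_, ⟨u, hu, rfl⟩, rfl⟩
    change tripleHom k _ ∈ _
    rw [tripleHom_lift]
    have h := wordImage_mem_component k (concat u)
    rw [length_concat] at h
    rwa [show u.length = n from hu] at h
  · rw [component_gen, Submodule.span_le]
    rintro _ ⟨w, ⟨-, hw⟩, rfl⟩
    obtain ⟨h1, h2⟩ := chop_spec k n (w := w.toList) hw
    exact ⟨_, h1, h2⟩

theorem veroneseHom_surjective : Function.Surjective (veroneseHom k) := by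
  have h : (⨆ n : ℕ, component k (gen k) (3 * n)) ≤ LinearMap.range (tripleHom k).toLinearMap := by
    refine iSup_le fun n => ?_
    rw [← map_component_tripleHom]
    exact LinearMap.map_le_range
  rintro ⟨x, hx⟩
  obtain ⟨y, hy⟩ := h ((mem_veronese k).1 hx)
  exact ⟨y, Subtype.ext ((val_veroneseHom k y).trans hy)⟩

theorem ker_veroneseHom : TwoSidedIdeal.ker (veroneseHom k) = quadraticIdeal k := by
  rw [← ker_tripleHom]
  ext x
  rw [TwoSidedIdeal.mem_ker, TwoSidedIdeal.mem_ker, ← val_veroneseHom, ZeroMemClass.coe_eq_zero]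

theorem basisFreeMonoid_apply {X : Type*} (w : FreeMonoid X) :
    FreeAlgebra.basisFreeMonoid k X w = FreeMonoid.lift (FreeAlgebra.ι k) w := by
  simp [FreeAlgebra.basisFreeMonoid, FreeAlgebra.equivMonoidAlgebraFreeMonoid]

theorem finrank_component_two :
    Module.finrank k (component k (FreeAlgebra.ι k : Fin 20 → F) 2) = 400 := by
  let e : List.Vector (Fin 20) 2 → F := fun w => FreeMonoid.lift (FreeAlgebra.ι k)
    (FreeMonoid.ofList w.1)
  have he : LinearIndependent k e := by
    have h := (FreeAlgebra.basisFreeMonoid k (Fin 20)).linearIndependent.comp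
      (fun w : List.Vector (Fin 20) 2 => FreeMonoid.ofList w.1)
      (fun v w h => Subtype.ext (FreeMonoid.ofList.injective h))
    have h' : FreeAlgebra.basisFreeMonoid k (Fin 20) ∘
        (fun w : List.Vector (Fin 20) 2 => FreeMonoid.ofList w.1) = e :=
      funext fun w => basisFreeMonoid_apply k _
    rw [h'] at h
    exact h
  have hr : component k (FreeAlgebra.ι k : Fin 20 → F) 2 = Submodule.span k (Set.range e) := by
    rw [component_eq_span]
    congr 1
    ext x
    constructor
    · rintro ⟨w, hw, rfl⟩
      exact ⟨⟨w.toList, hw⟩, rfl⟩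
    · rintro ⟨w, rfl⟩
      exact ⟨FreeMonoid.ofList w.1, w.2, rfl⟩
  rw [hr, finrank_span_eq_card he, card_vector]
  rfl

theorem finite_component_two :
    Module.Finite k (component k (FreeAlgebra.ι k : Fin 20 → F) 2) :=
  Module.finite_of_finrank_pos (by rw [finrank_component_two]; norm_num)

/-- Rank-nullity from degree two of the free algebra, of dimension `20² = 400`, onto `A_6`, of
dimension `119`. -/
theorem finrank_quadraticRelations : Module.finrank k (quadraticRelations k) = 281 := by
  have := finite_component_two k
  let f := (tripleHom k).toLinearMap.domRestrict (component k (FreeAlgebra.ι k : Fin 20 → F) 2)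
  have h1 : LinearMap.range f = component k (gen k) 6 := by
    rw [LinearMap.range_domRestrict]
    exact map_component_tripleHom k 2
  have h2 := LinearMap.finrank_range_add_finrank_ker f
  rw [h1, finrank_component, ncard_normalWords_six, finrank_component_two] at h2
  have h3 : (LinearMap.ker f).map (Submodule.subtype _) = quadraticRelations k := by
    ext x
    constructor
    · rintro ⟨⟨y, hy⟩, hy', rfl⟩
      exact ⟨hy, hy'⟩
    · rintro ⟨hx, hx'⟩
      exact ⟨⟨x, hx⟩, hx', rfl⟩
  rw [← h3, Submodule.finrank_map_subtype_eq]
  omega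

theorem hasQuadraticPresentation_veronese :
    HasQuadraticPresentation k V₃ (veroneseComponent k (gen k) 3 1) 20 281 := by
  have : Module.Finite k (quadraticRelations k) :=
    Module.finite_of_finrank_pos (by rw [finrank_quadraticRelations]; norm_num)
  let b := Module.finBasisOfFinrankEq k _ (finrank_quadraticRelations k)
  refine ⟨veroneseHom k, fun j => (b j : F), veroneseHom_surjective k, fun i => ?_,
    fun j => (b j).2.1, ?_, ?_⟩
  · rw [veroneseHom, FreeAlgebra.lift_ι_apply]
    exact wordImage_triple_mem_component k i
  · exact b.linearIndependent.map' (Submodule.subtype _) (Submodule.ker_subtype _)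
  · rw [ker_veroneseHom]
    set I := TwoSidedIdeal.span (Set.range fun j => (b j : F)) with hI
    apply le_antisymm
    · rw [quadraticIdeal, TwoSidedIdeal.span_le]
      intro x hx
      have h := b.sum_repr ⟨x, hx⟩
      -- Scalars are written as ring elements so that closure of the ideal under left multiplication
      -- applies.
      have h' : x = ∑ j, algebraMap k F (b.repr ⟨x, hx⟩ j) * (b j : F) := by
        have h'' := congrArg (Submodule.subtype _) h
        rw [map_sum] at h''
        simpa [Algebra.smul_def] using h''.symm
      rw [h']
      exact sum_mem fun j _ => I.mul_mem_left _ _ (TwoSidedIdeal.subset_span ⟨j, rfl⟩)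
    · rw [hI, TwoSidedIdeal.span_le]
      rintro _ ⟨j, rfl⟩
      exact TwoSidedIdeal.subset_span (b j).2

/-! ### Growth of the Veronese subalgebra -/

theorem lift_mem_unitSpan_pow {B : Type*} [Ring B] [Algebra k B] {X : Type*} {x : X → B} {S : Set B}
    (h : ∀ i, x i ∈ S) (u : FreeMonoid X) : FreeMonoid.lift x u ∈ unitSpan k S ^ u.length := by
  induction u using FreeMonoid.inductionOn' with
  | one => rw [map_one]; exact Submodule.one_le.1 le_rfl
  | of_mul i u ih =>
    rw [map_mul, FreeMonoid.lift_eval_of, FreeMonoid.length_mul, FreeMonoid.length_of, pow_add,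
      pow_one]
    exact Submodule.mul_mem_mul (Submodule.subset_span (Set.mem_insert_of_mem _ (h i))) ih

theorem algebraLift_monoidLift {B : Type*} [Ring B] [Algebra k B] {X : Type*} (x : X → B)
    (u : FreeMonoid X) :
    FreeAlgebra.lift k x (FreeMonoid.lift (FreeAlgebra.ι k) u) = FreeMonoid.lift x u := by
  induction u using FreeMonoid.inductionOn' with
  | one => simp
  | of_mul i u ih =>
    simp only [map_mul, FreeMonoid.lift_eval_of, FreeAlgebra.lift_ι_apply, ih]

open Classical in
/-- The generators of the Veronese subalgebra, as a finite set. -/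
noncomputable def veroneseGenerators : Finset V₃ := Finset.univ.image (veroneseGen k)

theorem coe_veroneseGenerators :
    (veroneseGenerators k : Set V₃) = Set.range (veroneseGen k) := by
  classical
  simp [veroneseGenerators]

theorem adjoin_veroneseGenerators : Algebra.adjoin k (veroneseGenerators k : Set V₃) = ⊤ := by
  rw [coe_veroneseGenerators, Algebra.adjoin_range_eq_range_freeAlgebra_lift]
  exact (AlgHom.range_eq_top _).2 (veroneseHom_surjective k)

/-- The inclusion into `A` is injective, so dimensions may be computed in `A` and compared there. -/
theorem growthFunction_veroneseGenerators (n : ℕ) :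
    growthFunction k (veroneseGenerators k) n =
      Module.finrank k ((unitSpan k (Set.range fun i => wordImage k (triple i))) ^ n :
        Submodule k (A k)) := by
  rw [growthFunction_eq, (Submodule.equivMapOfInjective (V₃).val.toLinearMap
    Subtype.val_injective _).finrank_eq, Submodule.map_pow, unitSpan, Submodule.map_span]
  change Module.finrank k (Submodule.span k ((V₃).val '' _) ^ n : Submodule k (A k)) = _
  rw [Set.image_insert_eq, map_one, coe_veroneseGenerators, ← Set.range_comp]
  rfl

theorem growthFunction_veroneseGenerators_le (n : ℕ) :
    growthFunction k (veroneseGenerators k) n ≤ growthFunction k (generators k) (3 * n) := by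
  have := finite_unitSpan_pow k (generators k) (3 * n)
  rw [growthFunction_veroneseGenerators, growthFunction_eq]
  refine Submodule.finrank_mono ?_
  rw [pow_mul]
  refine pow_le_pow_left' (Submodule.span_le.2 (Set.insert_subset ?_ ?_)) n
  · exact Submodule.one_le.1 (one_le_pow_of_one_le' (one_le_unitSpan k _) 3)
  · rintro _ ⟨i, rfl⟩
    have h := lift_mem_unitSpan_pow k (x := gen k) (S := (generators k : Set (A k)))
      (fun x => by rw [coe_generators]; exact ⟨x, rfl⟩) (triple i)
    rwa [length_triple, ← wordImage_eq_lift] at h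

/-- Products of `n` generators span all of `A_{3n}`. -/
theorem partitionCount_le_growthFunction_veroneseGenerators (n : ℕ) :
    partitionCount (3 * n) ≤ growthFunction k (veroneseGenerators k) n := by
  set S := Set.range fun i => wordImage k (triple i) with hS
  have : Module.Finite k (unitSpan k S ^ n : Submodule k (A k)) := by
    rw [Module.Finite.iff_fg]
    exact Submodule.FG.pow (Submodule.fg_span ((Set.finite_range _).insert 1)) n
  have hle : component k (gen k) (3 * n) ≤ unitSpan k S ^ n := by
    rw [← map_component_tripleHom, component_eq_span, Submodule.map_span, Submodule.span_le]
    rintro _ ⟨_, ⟨u, hu, rfl⟩, rfl⟩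
    have h := lift_mem_unitSpan_pow k (x := fun i => wordImage k (triple i)) (S := S)
      (fun i => ⟨i, rfl⟩) u
    rw [show u.length = n from hu] at h
    change tripleHom k (FreeMonoid.lift (FreeAlgebra.ι k) u) ∈ _
    rwa [tripleHom, algebraLift_monoidLift]
  refine (partitionCount_le_ncard (3 * n)).trans ?_
  rw [← finrank_component k, growthFunction_veroneseGenerators]
  exact Submodule.finrank_mono hle

theorem hasGrowthType_veronese :
    HasGrowthType k V₃ fun n => Real.exp (Real.sqrt (n : ℝ)) := by
  refine hasGrowthType_of_growthEquiv k (adjoin_veroneseGenerators k) ⟨?_, ?_⟩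
  -- `42 = 21 · 2`, from the bound for `A` at `3n` and `√(3n) ≤ 2√n`.
  · refine ⟨1, 42 ^ 2, one_pos, by norm_num, fun n hn => ?_⟩
    have h := growthFunction_generators_le k (n := 3 * n) (by omega)
    have h2 : Real.sqrt ((3 * n : ℕ) : ℝ) ≤ 2 * Real.sqrt n := by
      rw [Real.sqrt_le_left (by positivity), mul_pow, Real.sq_sqrt (by positivity)]
      push_cast
      have : (0 : ℝ) ≤ n := Nat.cast_nonneg n
      linarith
    beta_reduce
    rw [← exp_mul_sqrt]
    refine ((Nat.cast_le.2 (growthFunction_veroneseGenerators_le k n)).trans h).trans ?_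
    rw [Real.exp_le_exp, Nat.cast_ofNat]
    linarith
  · obtain ⟨N, C, hN, hC, h⟩ := exp_growthLE_partitionCount
    refine ⟨N, C, hN, hC, fun n hn => ?_⟩
    -- Used at `3n` because the Veronese growth function at `C n` dominates `p(3 C n)`.
    have h1 := h (3 * n) (by omega)
    have h2 : Real.exp (Real.sqrt n) ≤ Real.exp (Real.sqrt ((3 * n : ℕ) : ℝ)) := by
      gcongr
      omega
    refine h2.trans (h1.trans (Nat.cast_le.2 ?_))
    rw [Nat.mul_left_comm]
    exact partitionCount_le_growthFunction_veroneseGenerators k _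

end VeronesePresentation

end KobayashiAlgebra

theorem mainTheorem3 (k : Type*) [Field k] :
    -- `R_∞` is an infinite complete rewriting system for `A`, equivalent to the defining one
    (KobayashiAlgebra.ruleSetInf.Infinite ∧
      KobayashiAlgebra.ruleSetInf.IsComplete ∧
      KobayashiAlgebra.ruleSetInf.IsEquivalent KobayashiAlgebra.ruleSet ∧
      TwoSidedIdeal.ker (KobayashiAlgebra.proj k) =
        TwoSidedIdeal.span (KobayashiAlgebra.ruleSetInf.relators k)) ∧
    -- its irreducible words are the stated ones
    KobayashiAlgebra.ruleSetInf.irreducibleWords = KobayashiAlgebra.normalWords ∧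
    -- and they form a basis of `A`
    (LinearIndependent k (fun w : KobayashiAlgebra.ruleSetInf.irreducibleWords =>
        KobayashiAlgebra.wordImage k w) ∧
      Submodule.span k
        (KobayashiAlgebra.wordImage k '' KobayashiAlgebra.ruleSetInf.irreducibleWords) = ⊤) ∧
    -- growth of `A`
    (KobayashiAlgebra.HasGrowthType k (KobayashiAlgebra.A k)
        (fun n => (KobayashiAlgebra.partitionCount n : ℝ)) ∧
      KobayashiAlgebra.GrowthEquiv (fun n => (KobayashiAlgebra.partitionCount n : ℝ))
        (fun n => Real.exp (Real.sqrt (n : ℝ))) ∧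
      KobayashiAlgebra.HasGrowthType k (KobayashiAlgebra.A k)
        (fun n => Real.exp (Real.sqrt (n : ℝ))) ∧
      KobayashiAlgebra.HasIntermediateGrowth k (KobayashiAlgebra.A k)) ∧
    -- `A` is graded by the degree with `deg a = deg b = deg c = 1`
    DirectSum.IsInternal (KobayashiAlgebra.component k (KobayashiAlgebra.gen k)) ∧
    -- the Veronese subalgebra `V_3(A)`
    (KobayashiAlgebra.HasQuadraticPresentation k
        (KobayashiAlgebra.veronese k (KobayashiAlgebra.gen k) 3)
        (KobayashiAlgebra.veroneseComponent k (KobayashiAlgebra.gen k) 3 1) 20 281 ∧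
      KobayashiAlgebra.HasGrowthType k (KobayashiAlgebra.veronese k (KobayashiAlgebra.gen k) 3)
        (fun n => Real.exp (Real.sqrt (n : ℝ))) ∧
      KobayashiAlgebra.HasIntermediateGrowth k
        (KobayashiAlgebra.veronese k (KobayashiAlgebra.gen k) 3)) := by
  refine ⟨⟨KobayashiAlgebra.ruleSetInf_infinite, KobayashiAlgebra.ruleSetInf_isComplete,
    KobayashiAlgebra.ruleSetInf_isEquivalent, KobayashiAlgebra.ker_proj k⟩,
    KobayashiAlgebra.irreducibleWords_eq, ⟨?_, ?_⟩, ⟨?_,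
    KobayashiAlgebra.partitionCount_growthEquiv_exp, KobayashiAlgebra.hasGrowthType_exp k,
    (KobayashiAlgebra.hasGrowthType_exp k).hasIntermediateGrowth⟩,
    KobayashiAlgebra.isInternal_component k,
    KobayashiAlgebra.hasQuadraticPresentation_veronese k,
    KobayashiAlgebra.hasGrowthType_veronese k,
    (KobayashiAlgebra.hasGrowthType_veronese k).hasIntermediateGrowth⟩
  · rw [KobayashiAlgebra.irreducibleWords_eq]
    exact KobayashiAlgebra.linearIndepOn_normalWords k
  · rw [KobayashiAlgebra.irreducibleWords_eq]
    exact KobayashiAlgebra.span_normalWords k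
  · exact (KobayashiAlgebra.hasGrowthType_exp k).trans
      KobayashiAlgebra.partitionCount_growthEquiv_exp.symm
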